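/- **Notation.** For a number field $M$, write $\mathcal{O}_M$ for its ring of integers, $h_M$ for its class number and $\phi_M(\mathfrak a)=\#(\mathcal{O}_M/\mathfrak a)^\times$ for the totient of a nonzero ideal $\mathfrak a$ of $\mathcal{O}_M$. Let $\mathrm{Nm}(\mathfrak a)=\#(\mathcal{O}_M/\mathfrak a)$, let $\omega(\mathfrak a)$ be the number of distinct prime ideals dividing $\mathfrak a$, and let $\mathfrak a_2=\prod_{\mathfrak p\mid 2}\mathfrak p^{v_{\mathfrak p}(\mathfrak a)}$ be the $2$-part of $\mathfrak a$. Let $E$ be a CM field with maximal totally real subfield $F$, let $G=\mathrm{Gal}(E/F)$, and let $d_{E/F}$ be the relative discriminant, an ideal of $\mathcal{O}_F$, with $2$-part $d_{E/F,2}$. Define $$M_E=\frac{[\mathcal{O}_E^\times:\mathcal{O}_F^\times]\,h_F}{h_E}\cdot 2^{\omega(d_{E/F})+\omega(d_{E/F,2})}\cdot\sqrt{\mathrm{Nm}(d_{E/F,2})}.$$ For a nonzero prime $\mathfrak p$ of $\mathcal{O}_F$ let $e(\mathfrak p)$ be its ramification index in $E$. For an archimedean place $v$ of $F$ let $e(v)=2$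 if $v$ extends to a place $w$ of $E$ with $[E_w:F_v]=2$, and $e(v)=1$ otherwise. For a nonzero ideal $I$ of $\mathcal{O}_E$ with $\overline I=I$ (complex conjugation), put $J=I\cap\mathcal{O}_F$ and - $E^{I,1}=\{x\in E^\times : v(x-1)\ge v(I)\text{ for each finite place } v \text{ of } E \text{ with } v(I)>0\}$, - $\mathcal{O}_E^I=\mathcal{O}_E^\times\cap E^{I,1}$, - $H^1(E^{I,1})=\hat H^1(G,E^{I,1})$ (Tate cohomology), - $e(E/F,J)=\prod_{v\nmid J}e(v)$, where $v$ ranges over all places of $F$, finite and infinite, that do not divide $J$. Let $k$ be a number field. A nonzero ideal $I$ of $\mathcal{O}_E$ is called *$k$-permissible* if $\overline I=I$ and $$\frac{\phi_E(I)}{\phi_F(J)}\le\frac12\cdot[k:\mathbb{Q}]\cdot\frac{[\mathcal{O}_E^\times:\mathcal{O}_E^I]}{[\mathcal{O}_F^\times:N_{E/F}(\mathcal{O}_E^I)]}\cdot\frac{h_F}{h_E}\cdot e(E/F,J)\cdot\#H^1(E^{I,1}).$$ **Statement.** Let $k$ be a number field and let $E$ be a CM field with maximal totally real subfield $F$. Then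 for every $k$-permissible ideal $I$ of $\mathcal{O}_E$, with $J=I\cap\mathcal{O}_F$, one has $$\frac{\phi_E(I)}{\phi_F(J)}\le[k:\mathbb{Q}]\cdot M_E.$$ -/

import Mathlib

open NumberField IsDedekindDomain

noncomputable section

namespace K3Totient

universe u

/-! ### Ideals of the ring of integers of a number field -/

section Ideals

variable {M : Type*} [Field M]

/-- The Euler totient `φ_M(I) = #(𝓞_M / I)ˣ`. -/
def totient (I : Ideal (𝓞 M)) : ℕ := Nat.card ((𝓞 M) ⧸ I)ˣ

/-- `ω(I)`: the number of distinct (nonzero) prime ideals dividing the ideal `I`. -/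
def omega (I : Ideal (𝓞 M)) : ℕ := {p : HeightOneSpectrum (𝓞 M) | p.asIdeal ∣ I}.ncard

/-- `v_𝔭(I)`: the exponent of `𝔭` in the factorisation of the nonzero ideal `I`. -/
def ord (p : HeightOneSpectrum (𝓞 M)) (I : Ideal (𝓞 M)) : ℕ := multiplicity p.asIdeal I

/-- The `2`-part `I_2 = ∏_{𝔭 ∣ 2} 𝔭 ^ v_𝔭(I)` of a nonzero ideal `I`. -/
def twoPart (I : Ideal (𝓞 M)) : Ideal (𝓞 M) :=
  ∏ᶠ (p : HeightOneSpectrum (𝓞 M)) (_ : (2 : 𝓞 M) ∈ p.asIdeal), p.asIdeal ^ ord p I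

end Ideals

/-- The relative discriminant `d_{L/K}`: the ideal of `𝓞_K` generated by the discriminants of all
`K`-bases of `L` that consist of algebraic integers. -/
def relDiscr (K L : Type*) [Field K] [Field L] [Algebra K L] : Ideal (𝓞 K) :=
  Ideal.span {d : 𝓞 K | ∃ b : Module.Basis (Fin (Module.finrank K L)) K L,
    (∀ i, IsIntegral ℤ (b i)) ∧ (d : K) = Algebra.discr K b}

/-! ### CM fields -/

section CM

variable (E : Type u) [Field E] [NumberField E]

/-- The maximal totally real subfield `F` of `E`. -/
abbrev RealSub : Type u := maximalRealSubfield E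

/-- The ramification index `e(𝔭)` in `E` of a nonzero prime `𝔭` of `F`. -/
def eFinite (p : HeightOneSpectrum (𝓞 (RealSub E))) : ℕ := p.asIdeal.ramificationIdxIn (𝓞 E)

open scoped Classical in
/-- `e(v)` for an archimedean place `v` of `F`: it is `2` if some place of `E` above `v` is
ramified (so that the extension of completions is `ℂ / ℝ`), and `1` otherwise. -/
def eInfinite (v : InfinitePlace (RealSub E)) : ℕ :=
  if ∃ w : InfinitePlace E, w.comap (algebraMap (RealSub E) E) = v ∧ w.IsRamified (RealSub E)
  then 2 else 1

/-- `e(E/F, J) = ∏_{v ∤ J} e(v)`, over all places `v` of `F`, infinite and finite. -/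
def eAway (J : Ideal (𝓞 (RealSub E))) : ℕ :=
  (∏ v : InfinitePlace (RealSub E), eInfinite E v) *
    ∏ᶠ (p : HeightOneSpectrum (𝓞 (RealSub E))) (_ : ¬ p.asIdeal ∣ J), eFinite E p

/-- The constant
`M_E = [𝓞_Eˣ : 𝓞_Fˣ] h_F / h_E * 2 ^ (ω(d_{E/F}) + ω(d_{E/F,2})) * √(Nm(d_{E/F,2}))`. -/
def mConst : ℝ :=
  ((IsCMField.realUnits E).index : ℝ) * classNumber (RealSub E) / classNumber E *
    2 ^ (omega (relDiscr (RealSub E) E) + omega (twoPart (relDiscr (RealSub E) E))) *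
    √(Ideal.absNorm (twoPart (relDiscr (RealSub E) E)) : ℝ)

variable {E}

theorem valuation_eq_one_of_sub {v : HeightOneSpectrum (𝓞 E)} {n : ℕ} (hn : 0 < n) {x : E}
    (hx : v.valuation E (x - 1) ≤ WithZero.exp (-(n : ℤ))) : v.valuation E x = 1 := by
  have h : v.valuation E (x - 1) < 1 := by
    refine hx.trans_lt ?_
    rw [← WithZero.exp_zero, WithZero.exp_lt_exp]
    omega
  have := Valuation.map_one_add_of_lt (v.valuation E) h
  rwa [add_sub_cancel] at this

theorem valuation_le_one_of_sub {v : HeightOneSpectrum (𝓞 E)} {n : ℕ} (hn : 0 < n) {x : E}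
    (hx : v.valuation E (x - 1) ≤ WithZero.exp (-(n : ℤ))) : v.valuation E x ≤ 1 :=
  (valuation_eq_one_of_sub hn hx).le

/-- `E^{I,1} = {x ∈ Eˣ : v(x - 1) ≥ v(I) for each finite place v with v(I) > 0}`, for a nonzero
ideal `I`. Mathlib's valuations are multiplicative: `v(x - 1) ≥ n` is written as
`v.valuation E (x - 1) ≤ exp (-n)`. -/
def rayGroup (I : Ideal (𝓞 E)) : Subgroup Eˣ where
  carrier := {x | ∀ v : HeightOneSpectrum (𝓞 E), 0 < ord v I →
    v.valuation E ((x : E) - 1) ≤ WithZero.exp (-(ord v I : ℤ))}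
  one_mem' := by intro v _; simp
  mul_mem' := by
    intro x y hx hy v hv
    have h1 : v.valuation E (x : E) ≤ 1 := valuation_le_one_of_sub hv (hx v hv)
    have e : ((x * y : Eˣ) : E) - 1 = x * ((y : E) - 1) + ((x : E) - 1) := by
      push_cast; ring
    rw [e]
    refine Valuation.map_add_le _ ?_ (hx v hv)
    rw [map_mul]
    exact (mul_le_of_le_one_left' h1).trans (hy v hv)
  inv_mem' := by
    intro x hx v hv
    have h1 : v.valuation E (x : E) = 1 := valuation_eq_one_of_sub hv (hx v hv)
    have e : ((x⁻¹ : Eˣ) : E) - 1 = -((x : E)⁻¹ * ((x : E) - 1)) := by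
      have : (x : E) ≠ 0 := x.ne_zero
      push_cast
      field_simp
      ring
    rw [e, Valuation.map_neg, map_mul, map_inv₀, h1, inv_one, one_mul]
    exact hx v hv

/-- `𝓞_E^I = 𝓞_Eˣ ∩ E^{I,1}`, as a subgroup of `𝓞_Eˣ`. -/
def rayUnits (I : Ideal (𝓞 E)) : Subgroup (𝓞 E)ˣ :=
  (rayGroup I).comap (Units.map (algebraMap (𝓞 E) E).toMonoidHom)

variable [IsCMField E]

/-- The ideal `I` equals its complex conjugate. -/
def ConjInvariant (I : Ideal (𝓞 E)) : Prop :=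
  I.map (IsCMField.ringOfIntegersComplexConj E) = I

theorem pow_dvd_map_conj_iff (w : Ideal (𝓞 E)) (A : Ideal (𝓞 E)) (n : ℕ) :
    w.map (IsCMField.ringOfIntegersComplexConj E) ^ n ∣
      A.map (IsCMField.ringOfIntegersComplexConj E) ↔ w ^ n ∣ A := by
  rw [← Ideal.map_pow, Ideal.dvd_iff_le, Ideal.dvd_iff_le, Ideal.map_le_iff_le_comap,
    Ideal.comap_map_of_bijective _ (IsCMField.ringOfIntegersComplexConj E).bijective]

theorem conj_mem_rayGroup {I : Ideal (𝓞 E)} (hI : ConjInvariant I) {x : Eˣ}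
    (hx : x ∈ rayGroup I) : IsCMField.complexConj E • x ∈ rayGroup I := by
  intro v hv
  set c := IsCMField.ringOfIntegersComplexConj E with hc
  let w : HeightOneSpectrum (𝓞 E) :=
    { asIdeal := v.asIdeal.comap c
      isPrime := Ideal.comap_isPrime c v.asIdeal
      ne_bot := fun h ↦ v.ne_bot <| by
        rw [← Ideal.map_comap_of_surjective c c.surjective v.asIdeal, h, Ideal.map_bot] }
  have hw : w.asIdeal.map c = v.asIdeal :=
    Ideal.map_comap_of_surjective c c.surjective v.asIdeal
  have hem (A : Ideal (𝓞 E)) :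
      emultiplicity v.asIdeal (A.map c) = emultiplicity w.asIdeal A := by
    rw [← hw]
    exact emultiplicity_eq_emultiplicity_iff.2 fun n ↦ pow_dvd_map_conj_iff _ _ n
  have hord : ord v I = ord w I := by
    have := hem I
    rw [show I.map c = I from hI] at this
    exact multiplicity_eq_of_emultiplicity_eq this
  have hint (r : 𝓞 E) : v.intValuation (c r) = w.intValuation r := by
    by_cases hr : r = 0
    · simp [hr]
    have hr' : c r ≠ 0 := by simpa using hr
    rw [v.intValuation_eq_exp_neg_multiplicity hr', w.intValuation_eq_exp_neg_multiplicity hr]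
    have := hem (Ideal.span {r})
    rw [Ideal.map_span, Set.image_singleton] at this
    rw [multiplicity_eq_of_emultiplicity_eq this]
  have hval (y : E) :
      v.valuation E (IsCMField.complexConj E y) = w.valuation E y := by
    obtain ⟨a, b, hb, rfl⟩ := IsFractionRing.div_surjective (A := 𝓞 E) y
    have h (r : 𝓞 E) : IsCMField.complexConj E (algebraMap (𝓞 E) E r) =
        algebraMap (𝓞 E) E (c r) := rfl
    rw [map_div₀, h, h, map_div₀, map_div₀]
    simp only [HeightOneSpectrum.valuation_of_algebraMap, hint]
  have e : ((IsCMField.complexConj E • x : Eˣ) : E) - 1 =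
      IsCMField.complexConj E ((x : E) - 1) := by
    rw [map_sub, map_one]; rfl
  rw [e, hval, hord]
  exact hx w (hord ▸ hv)

theorem smul_mem_rayGroup {I : Ideal (𝓞 E)} (hI : ConjInvariant I) (σ : Gal(E/RealSub E))
    {x : Eˣ} (hx : x ∈ rayGroup I) : σ • x ∈ rayGroup I := by
  classical
  have hσ : σ ∈ Subgroup.zpowers (IsCMField.complexConj E) := by
    rw [IsCMField.zpowers_complexConj_eq_top]; trivial
  rw [mem_zpowers_iff_mem_range_orderOf, IsCMField.orderOf_complexConj] at hσ
  obtain ⟨n, hn, rfl⟩ := Finset.mem_image.1 hσ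
  rw [Finset.mem_range] at hn
  interval_cases n
  · simpa using hx
  · simpa using conj_mem_rayGroup hI hx

/-- The action of `G = Gal(E/F)` on `E^{I,1}` (written additively), for a conjugation-invariant
ideal `I`. The coefficient ring is `ℤ`, lifted to the universe of `E`. -/
def rayRepresentation {I : Ideal (𝓞 E)} (hI : ConjInvariant I) :
    Representation (ULift.{u} ℤ) Gal(E/RealSub E) (Additive (rayGroup I)) where
  toFun σ :=
    { toFun := fun x ↦ .ofMul ⟨σ • (x.toMul : Eˣ), smul_mem_rayGroup hI σ x.toMul.2⟩
      map_add' := fun x y ↦ congrArg Additive.ofMul <|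
        Subtype.ext (smul_mul' σ (x.toMul : Eˣ) (y.toMul : Eˣ))
      map_smul' := fun n x ↦ congrArg Additive.ofMul <|
        Subtype.ext (smul_zpow' σ (x.toMul : Eˣ) n.down) }
  map_one' := LinearMap.ext fun x ↦ congrArg Additive.ofMul <|
    Subtype.ext (one_smul _ (x.toMul : Eˣ))
  map_mul' σ τ := LinearMap.ext fun x ↦ congrArg Additive.ofMul <|
    Subtype.ext (mul_smul σ τ (x.toMul : Eˣ))

/-- `E^{I,1}` as a `G`-module. -/
def rayRep {I : Ideal (𝓞 E)} (hI : ConjInvariant I) : Rep.{u} (ULift.{u} ℤ) Gal(E/RealSub E) :=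
  Rep.of (rayRepresentation hI)

/-- The Tate cohomology group `H¹(E^{I,1}) = Ĥ¹(G, E^{I,1})`. -/
def rayH1 {I : Ideal (𝓞 E)} (hI : ConjInvariant I) : Type u :=
  tateCohomology (rayRep hI) 1

/-- The nonzero ideal `I` of `𝓞_E` is `k`-permissible; here `J = I ∩ 𝓞_F`. -/
structure IsPermissible (k : Type*) [Field k] [NumberField k] (I : Ideal (𝓞 E)) : Prop where
  ne_bot : I ≠ ⊥
  conj : ConjInvariant I
  le : (totient I : ℝ) / totient (I.under (𝓞 (RealSub E))) ≤
    1 / 2 * Module.finrank ℚ k *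
      (((rayUnits I).index : ℝ) /
        ((rayUnits I).map (Units.map (RingOfIntegers.norm (RealSub E)))).index) *
      ((classNumber (RealSub E) : ℝ) / classNumber E) *
      eAway E (I.under (𝓞 (RealSub E))) * Nat.card (rayH1 conj)

end CM

end K3Totient

end

/-! Permissibility bounds the totient quotient by a product of a unit ratio, a class number ratio,
`eAway` and `#H¹`. Each of these except the class number ratio is bounded separately, uniformly in
`I`.

Units (`index_rayUnits_mul_le`): the unit ratio equals `[ker N : ker N ∩ 𝓞_E^I] / [𝓞_Fˣ : N 𝓞_Eˣ]`.
Here `ker N` is a finite group of roots of unity meeting `𝓞_Fˣ` in at most two elements. Comparison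
with the same formula for the subgroup `𝓞_Fˣ`, whose norms are the squares, bounds the ratio by `2
[𝓞_Eˣ : 𝓞_Fˣ] / 2 ^ r`, where `r` is the number of infinite places of `F`. The factor `2` absorbs
the `1/2` in permissibility, and `2 ^ r` absorbs the infinite part of `eAway`.

Cohomology (`card_rayH1_le_two_pow_mul`): by Hilbert 90 a class is represented by some `y ∈ Eˣ` with
`y / ȳ ∈ E^{I,1}`, and it vanishes when `y ∈ Fˣ E^{I,1}`. Weak approximation in `F` makes the latter
a local question. Primes prime to `J` impose no condition, and unramified or odd primes give no
obstruction (`locallyReal_of_tame`). At a ramified dyadic `𝔭` with uniformizer `π` above it and `d =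
v(π - π̄)`, the obstruction is a parity bit and a class modulo `𝔭 ^ N` with `2 N ≤ d`
(`exists_local_invariant`). Since `𝔭 ^ d` divides the discriminant (`relDiscr_le`), the residue
classes together contribute at most the square root of the norm of its `2`-part.

Finally, the ramified primes dividing `J` (parity bits) and those not dividing it (`eAway`) are
together at most `ω(d_{E/F})` in number. -/

noncomputable section

namespace K3Totient

universe u

/-! ### Squares in the unit group of a field with a real embedding. -/

section Units

open NumberField.Units

variable (M : Type*) [Field M] [NumberField M]

/-- The logarithmic embedding as a map onto the unit lattice. -/
def toUnitLattice : Additive (𝓞 M)ˣ →+ unitLattice M :=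
  (logEmbedding M).codRestrict (unitLattice M) fun _ ↦
    Submodule.mem_map_of_mem (Submodule.mem_top (R := ℤ))

/-- The exponents of a unit with respect to a system of fundamental units, modulo `2`. -/
def unitExponentsModTwo : Additive (𝓞 M)ˣ →+ (Fin (rank M) → ZMod 2) where
  toFun x i := ((basisUnitLattice M).repr (toUnitLattice M x) i : ℤ)
  map_zero' := by
    ext i
    simp
  map_add' x y := by
    ext i
    simp

theorem unitExponentsModTwo_apply (x : Additive (𝓞 M)ˣ) (i : Fin (rank M)) :
    unitExponentsModTwo M x i = ((basisUnitLattice M).repr (toUnitLattice M x) i : ℤ) := rfl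

theorem unitExponentsModTwo_surjective : Function.Surjective (unitExponentsModTwo M) := by
  intro f
  choose g hg using fun i ↦ ZMod.intCast_surjective (f i)
  set y := (basisUnitLattice M).repr.symm (Finsupp.equivFunOnFinite.symm g) with hy
  obtain ⟨x, -, hx⟩ := Submodule.mem_map.1 y.2
  refine ⟨x, funext fun i ↦ ?_⟩
  have : toUnitLattice M x = y := Subtype.ext hx
  rw [unitExponentsModTwo_apply, this, hy]
  simp [hg]

theorem unitExponentsModTwo_eq_zero {x : (𝓞 M)ˣ} (hx : x ∈ torsion M) :
    unitExponentsModTwo M (Additive.ofMul x) = 0 := by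
  ext i
  have : toUnitLattice M (Additive.ofMul x) = 0 :=
    Subtype.ext (dirichletUnitTheorem.logEmbedding_eq_zero_iff.2 hx)
  rw [unitExponentsModTwo_apply, this]
  simp

/-- The squares have index at least `2 ^ (r + 1)` in the units of a number field with a real
place. -/
theorem two_pow_le_index_squares (φ : M →+* ℝ) :
    2 ^ (rank M + 1) ≤ (powMonoidHom 2 : (𝓞 M)ˣ →* (𝓞 M)ˣ).range.index := by
  set S := (powMonoidHom 2 : (𝓞 M)ˣ →* (𝓞 M)ˣ).range with hS
  let T : Subgroup (𝓞 M)ˣ := AddSubgroup.toSubgroup' (unitExponentsModTwo M).ker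
  have hmem (x : (𝓞 M)ˣ) : x ∈ T ↔ unitExponentsModTwo M (Additive.ofMul x) = 0 := Iff.rfl
  have hST : S ≤ T := by
    rintro _ ⟨x, rfl⟩
    rw [hmem]
    have : unitExponentsModTwo M (Additive.ofMul (x ^ 2)) =
      2 • unitExponentsModTwo M (Additive.ofMul x) := by rw [ofMul_pow, map_nsmul]
    ext i
    simp only [powMonoidHom_apply, this, Pi.smul_apply, nsmul_eq_mul, Pi.zero_apply]
    rw [show ((2 : ℕ) : ZMod 2) = 0 from rfl, zero_mul]
  have hT : T.index = 2 ^ rank M := by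
    have : T.index = (unitExponentsModTwo M).ker.index := rfl
    rw [this, AddSubgroup.index_ker, AddMonoidHom.range_eq_top.2 (unitExponentsModTwo_surjective M)]
    simp
  have : Group.FG (𝓞 M)ˣ := Group.fg_iff_monoid_fg.2 inferInstance
  have hfin : S.index ≠ 0 :=
    (Subgroup.finiteIndex_range_powMonoidHom_of_fg (𝓞 M)ˣ two_ne_zero).index_ne_zero
  rw [← Subgroup.relIndex_mul_index hST, hT, pow_succ, mul_comm]
  refine Nat.mul_le_mul_right _ ?_
  have h0 : S.relIndex T ≠ 0 := fun h ↦ hfin (by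
    rw [← Subgroup.relIndex_mul_index hST, h, zero_mul])
  -- The inclusion is strict: `-1` is torsion, hence in `T`, but a real embedding prevents it from
  -- being a square. This supplies the extra factor `2`.
  have h1 : S.relIndex T ≠ 1 := by
    rw [Ne, Subgroup.relIndex_eq_one]
    intro hle
    have hneg : (-1 : (𝓞 M)ˣ) ∈ T := by
      rw [hmem]
      exact unitExponentsModTwo_eq_zero M ((CommGroup.mem_torsion _).2
        (isOfFinOrder_iff_pow_eq_one.2 ⟨2, by norm_num, by simp⟩))
    obtain ⟨x, hx⟩ := hle hneg
    have h2 : (φ ((x : 𝓞 M) : M)) ^ 2 = -1 := by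
      have : ((x : 𝓞 M) : M) ^ 2 = -1 := by
        have := congrArg (fun u : (𝓞 M)ˣ ↦ ((u : 𝓞 M) : M)) hx
        simpa using this
      rw [← map_pow, this, map_neg, map_one]
    nlinarith [sq_nonneg (φ ((x : 𝓞 M) : M))]
  omega

end Units

/-! ### Norms of units in a CM extension and the unit ratio. -/

section CMUnits

variable (E : Type*) [Field E] [NumberField E] [IsCMField E]

/-- The norm `𝓞_Eˣ → 𝓞_Fˣ`. -/
abbrev unitsNorm : (𝓞 E)ˣ →* (𝓞 (RealSub E))ˣ := Units.map (RingOfIntegers.norm (RealSub E))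

variable {E}

theorem eq_one_or_eq_complexConj (τ : Gal(E/RealSub E)) :
    τ = 1 ∨ τ = IsCMField.complexConj E := by
  classical
  have hτ : τ ∈ Subgroup.zpowers (IsCMField.complexConj E) := by
    rw [IsCMField.zpowers_complexConj_eq_top]; trivial
  rw [mem_zpowers_iff_mem_range_orderOf, IsCMField.orderOf_complexConj] at hτ
  obtain ⟨n, hn, rfl⟩ := Finset.mem_image.1 hτ
  rw [Finset.mem_range] at hn
  interval_cases n <;> simp

open scoped Classical in
theorem univ_gal_eq :
    (Finset.univ : Finset Gal(E/RealSub E)) = {1, IsCMField.complexConj E} := by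
  ext τ
  simpa using eq_one_or_eq_complexConj τ

theorem algebraMap_norm_eq (x : E) :
    algebraMap (RealSub E) E (Algebra.norm (RealSub E) x) = x * IsCMField.complexConj E x := by
  classical
  rw [Algebra.norm_eq_prod_automorphisms, univ_gal_eq,
    Finset.prod_pair (IsCMField.complexConj_ne_one E).symm]
  rfl

theorem algebraMap_trace_eq (x : E) :
    algebraMap (RealSub E) E (Algebra.trace (RealSub E) E x) =
      x + IsCMField.complexConj E x := by
  classical
  rw [trace_eq_sum_automorphisms, univ_gal_eq,
    Finset.sum_pair (IsCMField.complexConj_ne_one E).symm]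
  rfl

/-- Complex conjugation preserves every archimedean absolute value, so `u ū = 1` forces `|u| = 1`
everywhere. -/
theorem unitsNorm_ker_le_torsion : (unitsNorm E).ker ≤ NumberField.Units.torsion E := by
  intro u hu
  rw [NumberField.Units.mem_torsion]
  intro w
  have h1 : Algebra.norm (RealSub E) ((u : 𝓞 E) : E) = 1 := by
    have := congrArg (fun v : (𝓞 (RealSub E))ˣ ↦ ((v : 𝓞 (RealSub E)) : RealSub E)) hu
    simpa using this
  have h2 := algebraMap_norm_eq ((u : 𝓞 E) : E)
  rw [h1, map_one] at h2
  have h3 := congrArg w h2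
  rw [map_one, map_mul, IsCMField.infinitePlace_complexConj] at h3
  nlinarith [apply_nonneg w ((u : 𝓞 E) : E)]

/-- For `X = W` and `X = V`, the index of `X` is `[ker N : X ∩ ker N]` times `[𝓞_Eˣ : X ker N]`, and
the index of `N X` is the latter factor times `[𝓞_Fˣ : N 𝓞_Eˣ]`. Thus only the indices inside `ker
N` have to be compared, and `N V` is the group of squares. -/
theorem index_rayUnits_mul_le (I : Ideal (𝓞 E)) :
    (rayUnits I).index * 2 ^ Fintype.card (InfinitePlace (RealSub E)) ≤
      2 * (IsCMField.realUnits E).index * ((rayUnits I).map (unitsNorm E)).index := by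
  classical
  set N := unitsNorm E
  set W := rayUnits I
  set V := IsCMField.realUnits E
  have hKfin : Finite N.ker :=
    Finite.of_injective _ (Subgroup.inclusion_injective (unitsNorm_ker_le_torsion (E := E)))
  have hVmap : V.map N = (powMonoidHom 2 : (𝓞 (RealSub E))ˣ →* _).range := by
    have hr : N.comp (Units.map (algebraMap (𝓞 (RealSub E)) (𝓞 E)).toMonoidHom) =
        powMonoidHom 2 := by
      ext u
      have : RingOfIntegers.norm (RealSub E) (algebraMap (𝓞 (RealSub E)) (𝓞 E) u) =
        (u : 𝓞 (RealSub E)) ^ 2 := by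
        rw [RingOfIntegers.norm_algebraMap, Algebra.IsQuadraticExtension.finrank_eq_two]
      simpa [N] using congrArg (fun x : 𝓞 (RealSub E) ↦ (x : E)) this
    rw [← hr, MonoidHom.range_comp]
    rfl
  have hcard : 2 ^ Fintype.card (InfinitePlace (RealSub E)) ≤ (V.map N).index := by
    rw [hVmap]
    have := two_pow_le_index_squares (RealSub E)
      (InfinitePlace.embedding_of_isReal (IsTotallyReal.isReal
        (Classical.arbitrary (InfinitePlace (RealSub E)))))
    rwa [NumberField.Units.rank, Nat.sub_add_cancel Fintype.card_pos] at this
  have h1 : (W.map N).index = (W ⊔ N.ker).index * N.range.index := Subgroup.index_map _ _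
  have h2 : (V.map N).index = (V ⊔ N.ker).index * N.range.index := Subgroup.index_map _ _
  have h3 : W.relIndex N.ker * (W ⊔ N.ker).index = W.index := by
    rw [sup_comm, ← Subgroup.relIndex_sup_right N.ker W, Subgroup.relIndex_mul_index le_sup_right]
  have h4 : V.relIndex N.ker * (V ⊔ N.ker).index = V.index := by
    rw [sup_comm, ← Subgroup.relIndex_sup_right N.ker V, Subgroup.relIndex_mul_index le_sup_right]
  have h5 : W.relIndex N.ker ≤ Nat.card N.ker :=
    Nat.card_le_card_of_surjective _ (QuotientGroup.mk_surjective (s := W.subgroupOf N.ker))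
  have h6 : Nat.card N.ker ≤ 2 * V.relIndex N.ker := by
    rw [← Subgroup.card_mul_index (V.subgroupOf N.ker)]
    refine Nat.mul_le_mul_right _ ?_
    -- The norm of `v ∈ 𝓞_Fˣ` is `v ^ 2`, so `V ∩ ker N` lies in `{1, -1}`.
    let f : V.subgroupOf N.ker → ({1, -1} : Finset (𝓞 E)ˣ) := fun x ↦ ⟨x.1.1, by
      obtain ⟨⟨x, hx⟩, hxV⟩ := x
      obtain ⟨v, rfl⟩ : x ∈ (Units.map (algebraMap (𝓞 (RealSub E)) (𝓞 E)).toMonoidHom).range := hxV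
      have hx' : RingOfIntegers.norm (RealSub E) (algebraMap (𝓞 (RealSub E)) (𝓞 E) v) = 1 :=
        congrArg Units.val hx
      rw [RingOfIntegers.norm_algebraMap, Algebra.IsQuadraticExtension.finrank_eq_two,
        sq_eq_one_iff] at hx'
      simp only [Finset.mem_insert, Finset.mem_singleton]
      rcases hx' with h | h
      · left; ext; simp [h]
      · right; ext; simp [h]⟩
    have hf : Function.Injective f := fun x y h ↦
      Subtype.ext (Subtype.ext (congrArg (fun z ↦ z.1) h))
    refine (Nat.card_le_card_of_injective f hf).trans ?_
    rw [Nat.card_eq_fintype_card, Fintype.card_coe]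
    exact Finset.card_le_two
  calc W.index * 2 ^ Fintype.card (InfinitePlace (RealSub E))
      ≤ (W.relIndex N.ker * (W ⊔ N.ker).index) * ((V ⊔ N.ker).index * N.range.index) := by
        rw [h3, ← h2]; exact Nat.mul_le_mul_left _ hcard
    _ ≤ ((2 * V.relIndex N.ker) * (W ⊔ N.ker).index) * ((V ⊔ N.ker).index * N.range.index) := by
        gcongr; exact h5.trans h6
    _ = _ := by rw [h1, ← h4]; ring

end CMUnits

/-! ### Approximation at finite places of a Dedekind domain. -/

section WeakApproximation

open scoped nonZeroDivisors

variable {R K : Type*} [CommRing R] [IsDedekindDomain R] [Field K] [Algebra R K]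
  [IsFractionRing R K]

theorem valuation_algebraMap_le_iff (v : HeightOneSpectrum R) (r : R) (n : ℕ) :
    v.valuation K (algebraMap R K r) ≤ WithZero.exp (-(n : ℤ)) ↔ r ∈ v.asIdeal ^ n := by
  rw [HeightOneSpectrum.valuation_of_algebraMap, HeightOneSpectrum.intValuation_le_pow_iff_mem]

/-- Weak approximation for finitely many finite places. -/
theorem exists_forall_valuation_sub_le (s : Finset (HeightOneSpectrum R))
    (x : HeightOneSpectrum R → K) (M : ℕ) :
    ∃ a : K, ∀ v ∈ s, v.valuation K (a - x v) ≤ WithZero.exp (-(M : ℤ)) := by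
  obtain ⟨b, hb⟩ := IsLocalization.exist_integer_multiples R⁰ s x
  have hb0 : (b : R) ≠ 0 := nonZeroDivisors.ne_zero b.2
  have hbK : algebraMap R K b ≠ 0 := by
    simp [hb0]
  have hc : ∀ v : s, ∃ r : R, algebraMap R K r = algebraMap R K b * x v := fun v ↦ by
    obtain ⟨r, hr⟩ := hb v v.2
    exact ⟨r, by rw [hr, Algebra.smul_def]⟩
  choose c hc using hc
  -- The Chinese remainder theorem is applied to the cleared numerators; the extra exponent `v(b)`
  -- pays for dividing by the common denominator `b`.
  obtain ⟨y, hy⟩ := exists_forall_sub_mem_ideal (s := s) (fun v ↦ v.asIdeal)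
    (fun v ↦ M + multiplicity v.asIdeal (Ideal.span {(b : R)})) (fun v _ ↦ v.prime)
    (fun v _ w _ hvw h ↦ hvw (HeightOneSpectrum.ext h)) c
  refine ⟨algebraMap R K y / algebraMap R K b, fun v hv ↦ ?_⟩
  have e : algebraMap R K y / algebraMap R K b - x v =
      algebraMap R K (y - c ⟨v, hv⟩) / algebraMap R K b := by
    rw [map_sub, hc]
    field_simp
  have h := (valuation_algebraMap_le_iff (K := K) v _ _).2 (hy v hv)
  rw [e, map_div₀, HeightOneSpectrum.valuation_of_algebraMap v (b : R),
    v.intValuation_eq_exp_neg_multiplicity hb0]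
  rw [div_le_iff₀ (WithZero.exp_pos), ← WithZero.exp_add]
  refine h.trans (le_of_eq ?_)
  congr 1
  push_cast
  ring

theorem exists_valuation_sub_algebraMap_le (v : HeightOneSpectrum R) {x : K}
    (hx : v.valuation K x ≤ 1) (N : ℕ) :
    ∃ r : R, v.valuation K (x - algebraMap R K r) ≤ WithZero.exp (-(N : ℤ)) := by
  obtain ⟨r, hr⟩ := v.exists_valuation_sub_lt_of_integer hx
    (Units.mk0 (WithZero.exp (-(N : ℤ))) WithZero.exp_ne_zero)
  refine ⟨r, ?_⟩
  rw [Valuation.map_sub_swap]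
  exact hr.le

theorem exists_valuation_eq_exp (v : HeightOneSpectrum R) {x : K} (hx : x ≠ 0) :
    ∃ m : ℤ, v.valuation K x = WithZero.exp m :=
  ⟨WithZero.log (v.valuation K x), (WithZero.exp_log ((v.valuation K).ne_zero_iff.2 hx)).symm⟩

end WeakApproximation

/-! ### Complex conjugation and the primes above a prime of `F`. -/

section Conjugation

variable {E : Type u} [Field E] [NumberField E] [IsCMField E]

local notation "c" => IsCMField.complexConj E

theorem exists_algebraMap_eq {x : E} (hx : c x = x) : ∃ a : RealSub E, algebraMap (RealSub E) E a = x :=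
  ⟨⟨x, (IsCMField.complexConj_eq_self_iff E x).1 hx⟩, rfl⟩

theorem complexConj_algebraMap (a : RealSub E) : c (algebraMap (RealSub E) E a) = algebraMap (RealSub E) E a :=
  AlgEquiv.commutes _ a

theorem complexConj_complexConj (x : E) : c (c x) = x := IsCMField.complexConj_apply_apply E x

variable (p : HeightOneSpectrum (𝓞 (RealSub E))) (P Q : HeightOneSpectrum (𝓞 E))

local notation "σ" => IsCMField.ringOfIntegersComplexConj E

/-- The prime `P` of `E` lies above the prime `p` of `F`. -/
abbrev Above (P : HeightOneSpectrum (𝓞 E)) (p : HeightOneSpectrum (𝓞 (RealSub E))) : Prop :=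
  Ideal.LiesOver (A := 𝓞 (RealSub E)) P.asIdeal p.asIdeal

/-- The norm `x x̄` comes from `F`, so its membership in a prime above `p` depends on `p` only. -/
theorem mem_asIdeal_of_mul_conj_mem [Above P p] [Above Q p]
    {x : 𝓞 E} (hx : x ∈ P.asIdeal) : x * σ x ∈ Q.asIdeal := by
  obtain ⟨a, ha⟩ : ∃ a : 𝓞 (RealSub E), algebraMap (𝓞 (RealSub E)) (𝓞 E) a = x * σ x := by
    refine (IsCMField.ringOfIntegersComplexConj_eq_self_iff E _).1 ?_
    ext
    simp [mul_comm]
  have h1 : x * σ x ∈ P.asIdeal := Ideal.mul_mem_right _ _ hx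
  rw [← ha] at h1 ⊢
  rw [← Ideal.mem_of_liesOver P.asIdeal p.asIdeal] at h1
  rwa [← Ideal.mem_of_liesOver Q.asIdeal p.asIdeal]

/-- If `𝔭` is unramified, some integer is moved by complex conjugation modulo all primes
above `𝔭`. -/
theorem exists_forall_conj_sub_notMem (hp : eFinite E p = 1) :
    ∃ x : 𝓞 E, ∀ P : HeightOneSpectrum (𝓞 E), Above P p →
      σ x - x ∉ P.asIdeal := by
  obtain ⟨⟨P₀, hP₀, hP₀'⟩⟩ := (inferInstance : Nonempty (Ideal.primesOver p.asIdeal (𝓞 E)))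
  -- The inertia group has order `e = 1`, so conjugation acts nontrivially modulo `P₀`. A single `x`
  -- then serves all primes above `p`: `x̄ - x` is anti-invariant, so its norm is minus its square.
  have hcard := Ideal.card_inertia_eq_ramificationIdxIn (G := Gal(E/RealSub E)) p.asIdeal P₀
  rw [show p.asIdeal.ramificationIdxIn (𝓞 E) = 1 from hp, Subgroup.card_eq_one] at hcard
  have hc : c ∉ P₀.inertia Gal(E/RealSub E) := by
    rw [hcard, Subgroup.mem_bot]
    exact IsCMField.complexConj_ne_one E
  have hc' : ¬ ∀ x : 𝓞 E, σ x - x ∈ P₀ := hc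
  push Not at hc'
  obtain ⟨x, hx⟩ := hc'
  refine ⟨x, fun P hP hxP ↦ hx ?_⟩
  let Q : HeightOneSpectrum (𝓞 E) := ⟨P₀, hP₀, Ideal.ne_bot_of_liesOver_of_ne_bot p.ne_bot P₀⟩
  have : Above Q p := hP₀'
  have h := mem_asIdeal_of_mul_conj_mem p P Q hxP
  have h2 : σ (σ x - x) = -(σ x - x) := by
    ext
    simp
  rw [h2, mul_neg, neg_mem_iff] at h
  exact (hP₀.mem_or_mem h).elim id id

variable {p P Q}

section Ramified

variable (hp : eFinite E p ≠ 1)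
include hp

/-- The inertia group is nontrivial in a group of order two, hence contains conjugation. -/
theorem conj_sub_mem_of_ramified [Above P p] (x : 𝓞 E) :
    σ x - x ∈ P.asIdeal := by
  have hcard := Ideal.card_inertia_eq_ramificationIdxIn (G := Gal(E/RealSub E)) p.asIdeal P.asIdeal
  have h1 : P.asIdeal.inertia Gal(E/RealSub E) ≠ ⊥ := fun h ↦ hp (by
    rw [eFinite, ← hcard, h, Subgroup.card_bot])
  obtain ⟨τ, hτ1⟩ := Subgroup.ne_bot_iff_exists_ne_one.1 h1
  have h2 : (τ : Gal(E/RealSub E)) = c :=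
    (eq_one_or_eq_complexConj _).resolve_left fun h ↦ hτ1 (Subtype.ext h)
  have h3 := τ.2
  rw [h2] at h3
  exact h3 x

theorem eq_of_above_of_ramified [Above P p] [Above Q p] : P = Q := by
  refine HeightOneSpectrum.ext ((P.isMaximal.eq_of_le Q.isPrime.ne_top) fun x hx ↦ ?_)
  refine (Q.isPrime.mem_or_mem (mem_asIdeal_of_mul_conj_mem p P Q hx)).elim id fun h ↦ ?_
  simpa using sub_mem h (conj_sub_mem_of_ramified (P := Q) hp x)

theorem eFinite_eq_two [Above P p] : eFinite E p = 2 := by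
  have hcard := Ideal.card_inertia_eq_ramificationIdxIn (G := Gal(E/RealSub E)) p.asIdeal P.asIdeal
  have : P.asIdeal.inertia Gal(E/RealSub E) = ⊤ := by
    refine (Subgroup.eq_top_iff' _).2 fun τ ↦ ?_
    rcases eq_one_or_eq_complexConj τ with rfl | rfl
    · exact one_mem _
    · exact conj_sub_mem_of_ramified hp
  rw [eFinite, ← hcard, this, Subgroup.card_top, IsGalois.card_aut_eq_finrank,
    Algebra.IsQuadraticExtension.finrank_eq_two]

/-- This is the source of all parity arguments below: elements of `F` have even valuation at `P`. -/
theorem valuation_algebraMap_of_ramified [Above P p] (a : RealSub E) :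
    P.valuation E (algebraMap (RealSub E) E a) = p.valuation (RealSub E) a ^ 2 := by
  rw [← HeightOneSpectrum.valuation_liesOver E p P, Ideal.ramificationIdx'_eq_ramificationIdx _ _
    p.ne_bot, ← Ideal.ramificationIdxIn_eq_ramificationIdx p.asIdeal P.asIdeal Gal(E/RealSub E)]
  exact congrArg _ (eFinite_eq_two hp (P := P))

theorem map_conj_of_ramified [Above P p] : P.asIdeal.map σ = P.asIdeal := by
  have h (x : 𝓞 E) (hx : x ∈ P.asIdeal) : σ x ∈ P.asIdeal := by
    simpa using add_mem (conj_sub_mem_of_ramified (P := P) hp x) hx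
  refine le_antisymm (Ideal.map_le_iff_le_comap.2 h) fun x hx ↦ ?_
  have h2 : σ (σ x) = x := by ext; simp
  rw [← h2]
  exact Ideal.mem_map_of_mem _ (h x hx)

theorem valuation_complexConj_of_ramified [Above P p] (x : E) :
    P.valuation E (c x) = P.valuation E x := by
  have hem (A : Ideal (𝓞 E)) :
      emultiplicity P.asIdeal (A.map σ) = emultiplicity P.asIdeal A := by
    refine emultiplicity_eq_emultiplicity_iff.2 fun n ↦ ?_
    conv_lhs => rw [← map_conj_of_ramified hp (P := P)]
    exact pow_dvd_map_conj_iff _ _ n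
  have hval_int (r : 𝓞 E) : P.intValuation (σ r) = P.intValuation r := by
    by_cases hr : r = 0
    · simp [hr]
    have hr' : σ r ≠ 0 := by simpa using hr
    rw [P.intValuation_eq_exp_neg_multiplicity hr', P.intValuation_eq_exp_neg_multiplicity hr]
    have := hem (Ideal.span {r})
    rw [Ideal.map_span, Set.image_singleton] at this
    rw [multiplicity_eq_of_emultiplicity_eq this]
  obtain ⟨a, b, hb, rfl⟩ := IsFractionRing.div_surjective (A := 𝓞 E) x
  have h (r : 𝓞 E) : c (algebraMap (𝓞 E) E r) = algebraMap (𝓞 E) E (σ r) := rfl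
  rw [map_div₀, h, h, map_div₀, map_div₀]
  simp only [HeightOneSpectrum.valuation_of_algebraMap, hval_int]

end Ramified

end Conjugation

/-! ### Local analysis at a ramified prime. -/

section RamifiedLocal

variable {E : Type u} [Field E] [NumberField E] [IsCMField E]

local notation "c" => IsCMField.complexConj E

variable {p : HeightOneSpectrum (𝓞 (RealSub E))} {P : HeightOneSpectrum (𝓞 E)} [Above P p]
  (hp : eFinite E p ≠ 1) {π : E} (hπ : P.valuation E π = WithZero.exp (-1))

include hp in
theorem exists_uniformizer_conj_sub :
    ∃ (π : E) (d : ℕ), P.valuation E π = WithZero.exp (-1) ∧ 1 ≤ d ∧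
      P.valuation E (π - c π) = WithZero.exp (-(d : ℤ)) := by
  obtain ⟨ϖ, hϖ⟩ := P.intValuation_exists_uniformizer
  have h1 : P.valuation E (ϖ : E) = WithZero.exp (-1) := by
    rw [← hϖ]; exact P.valuation_of_algebraMap ϖ
  -- A uniformizer has odd valuation, so it cannot lie in `F`.
  have h2 : (ϖ : E) - c ϖ ≠ 0 := fun h ↦ by
    obtain ⟨a, ha⟩ := exists_algebraMap_eq (sub_eq_zero.1 h).symm
    rw [← ha, valuation_algebraMap_of_ramified hp] at h1
    have ha0 : a ≠ 0 := by
      rintro rfl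
      simp [WithZero.exp_ne_zero.symm] at h1
    obtain ⟨m, hm⟩ := exists_valuation_eq_exp p ha0
    rw [hm, ← WithZero.exp_nsmul, WithZero.exp_inj] at h1
    simp at h1
    omega
  obtain ⟨m, hm⟩ := exists_valuation_eq_exp P h2
  have h3 : P.valuation E ((ϖ : E) - c ϖ) ≤ WithZero.exp (-((1 : ℕ) : ℤ)) := by
    have h4 := conj_sub_mem_of_ramified (P := P) hp ϖ
    rw [← pow_one P.asIdeal, ← valuation_algebraMap_le_iff (K := E)] at h4
    rw [Valuation.map_sub_swap]
    exact h4
  rw [hm, WithZero.exp_le_exp] at h3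
  push_cast at h3
  refine ⟨ϖ, (-m).toNat, h1, by omega, ?_⟩
  rw [hm]
  congr 1
  omega

include hp hπ

/-- For nonzero `a` and `b` the first term has even valuation and the second odd, so no cancellation
is possible. -/
theorem valuation_add_mul_uniformizer (a b : RealSub E) :
    P.valuation E (algebraMap (RealSub E) E a + algebraMap (RealSub E) E b * π) =
      max (P.valuation E (algebraMap (RealSub E) E a))
        (P.valuation E (algebraMap (RealSub E) E b * π)) := by
  by_cases h : P.valuation E (algebraMap (RealSub E) E a) =
      P.valuation E (algebraMap (RealSub E) E b * π)
  · rw [map_mul, valuation_algebraMap_of_ramified hp, valuation_algebraMap_of_ramified hp, hπ] at h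
    by_cases hb : b = 0
    · simp [hb]
    by_cases ha : a = 0
    · simp [ha]
    obtain ⟨m, hm⟩ := exists_valuation_eq_exp p ha
    obtain ⟨n, hn⟩ := exists_valuation_eq_exp p hb
    rw [hm, hn, ← WithZero.exp_nsmul, ← WithZero.exp_nsmul, ← WithZero.exp_add,
      WithZero.exp_inj] at h
    simp at h
    omega
  · exact Valuation.map_add_of_distinct_val _ h

theorem conj_sub_uniformizer_ne_zero : π - c π ≠ 0 := fun h ↦ by
  obtain ⟨a, ha⟩ := exists_algebraMap_eq (sub_eq_zero.1 h).symm
  have h1 := valuation_add_mul_uniformizer hp hπ a (-1)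
  rw [← ha] at h1 hπ
  simp only [map_neg, map_one, neg_mul, one_mul, add_neg_cancel, map_zero, Valuation.map_neg,
    hπ, max_self] at h1
  simp [WithZero.exp_ne_zero.symm] at h1

theorem exists_eq_add_mul_uniformizer (y : E) :
    ∃ a b : RealSub E, y = algebraMap (RealSub E) E a + algebraMap (RealSub E) E b * π := by
  have h0 := conj_sub_uniformizer_ne_zero hp hπ
  have h0' : c π - π ≠ 0 := fun h ↦ h0 (by rw [← neg_sub, h, neg_zero])
  -- The formulas for `b` and `a` solve the system `y = a + bπ`, `ȳ = a + bπ̄`.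
  obtain ⟨b, hb⟩ := exists_algebraMap_eq (x := (y - c y) / (π - c π)) (by
    rw [map_div₀, map_sub, map_sub, complexConj_complexConj, complexConj_complexConj]
    field_simp
    ring)
  obtain ⟨a, ha⟩ := exists_algebraMap_eq (x := y - (y - c y) / (π - c π) * π) (by
    rw [map_sub, map_mul, map_div₀, map_sub, map_sub, complexConj_complexConj,
      complexConj_complexConj]
    field_simp
    ring)
  exact ⟨a, b, by rw [ha, hb]; ring⟩

/-- In the coordinates `a + bπ`, an integral basis has coefficients integral at `p`, and its
discriminant is the square of the coefficient determinant times `π - π̄`. Its valuation is therefore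
at least `2d` at `P`, that is, at least `d` at `p`. -/
theorem relDiscr_le {d : ℕ} (hd : P.valuation E (π - c π) ≤ WithZero.exp (-(d : ℤ))) :
    relDiscr (RealSub E) E ≤ p.asIdeal ^ d := by
  refine Ideal.span_le.2 ?_
  rintro D ⟨b, hb, hD⟩
  rw [SetLike.mem_coe, ← valuation_algebraMap_le_iff (K := RealSub E)]
  have hD : algebraMap (𝓞 (RealSub E)) (RealSub E) D = Algebra.discr (RealSub E) b := hD
  rw [hD]
  let e : Fin (Module.finrank (RealSub E) E) ≃ Fin 2 :=
    finCongr (Algebra.IsQuadraticExtension.finrank_eq_two (RealSub E) E)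
  have hdisc : algebraMap (RealSub E) E (Algebra.discr (RealSub E) b) =
      (b (e.symm 0) * c (b (e.symm 1)) - b (e.symm 1) * c (b (e.symm 0))) ^ 2 := by
    rw [← Algebra.discr_reindex (RealSub E) b e, Algebra.discr_def, Matrix.det_fin_two]
    simp only [Algebra.traceMatrix_apply, Algebra.traceForm_apply, Function.comp_apply, map_sub,
      map_mul, algebraMap_trace_eq]
    ring
  have hval_int (i : Fin (Module.finrank (RealSub E) E)) : P.valuation E (b i) ≤ 1 :=
    P.valuation_le_one (⟨b i, hb i⟩ : 𝓞 E)
  obtain ⟨a₀, b₀, h₀⟩ := exists_eq_add_mul_uniformizer hp hπ (b (e.symm 0))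
  obtain ⟨a₁, b₁, h₁⟩ := exists_eq_add_mul_uniformizer hp hπ (b (e.symm 1))
  have key (x y : RealSub E) (h : P.valuation E (algebraMap (RealSub E) E x +
      algebraMap (RealSub E) E y * π) ≤ 1) :
      P.valuation E (algebraMap (RealSub E) E x) ≤ 1 ∧
        P.valuation E (algebraMap (RealSub E) E y) ≤ 1 := by
    rw [valuation_add_mul_uniformizer hp hπ, max_le_iff] at h
    refine ⟨h.1, ?_⟩
    have h2 := h.2
    rw [map_mul, hπ, valuation_algebraMap_of_ramified hp] at h2
    rw [valuation_algebraMap_of_ramified hp]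
    by_cases hy : y = 0
    · simp [hy]
    obtain ⟨m, hm⟩ := exists_valuation_eq_exp p hy
    rw [hm, ← WithZero.exp_nsmul, ← WithZero.exp_add, ← WithZero.exp_zero,
      WithZero.exp_le_exp] at h2
    rw [hm, ← WithZero.exp_nsmul, ← WithZero.exp_zero, WithZero.exp_le_exp]
    simp at h2 ⊢
    omega
  obtain ⟨ha₀, hb₀⟩ := key _ _ (h₀ ▸ hval_int _)
  obtain ⟨ha₁, hb₁⟩ := key _ _ (h₁ ▸ hval_int _)
  have hsq : p.valuation (RealSub E) (Algebra.discr (RealSub E) b) ^ 2 ≤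
      WithZero.exp (-(d : ℤ)) ^ 2 := by
    rw [← valuation_algebraMap_of_ramified (P := P) hp, hdisc, map_pow]
    refine pow_le_pow_left₀ zero_le ?_ 2
    have : b (e.symm 0) * c (b (e.symm 1)) - b (e.symm 1) * c (b (e.symm 0)) =
        (algebraMap (RealSub E) E a₁ * algebraMap (RealSub E) E b₀ -
          algebraMap (RealSub E) E a₀ * algebraMap (RealSub E) E b₁) * (π - c π) := by
      rw [h₀, h₁]
      simp only [map_add, map_mul, complexConj_algebraMap]
      ring
    rw [this, map_mul]
    refine mul_le_of_le_one_of_le ?_ hd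
    refine Valuation.map_sub_le _ ?_ ?_
    · rw [map_mul]; exact mul_le_one' ha₁ hb₀
    · rw [map_mul]; exact mul_le_one' ha₀ hb₁
  exact le_of_pow_le_pow_left₀ two_ne_zero zero_le hsq

/-- In `y = a + bπ` with even valuation, `a` must be the dominant term; then `β = b / a` is
integral. -/
theorem exists_eq_mul_one_add {y : E} {a' : RealSub E} (ha' : a' ≠ 0)
    (hy : P.valuation E y = P.valuation E (algebraMap (RealSub E) E a')) :
    ∃ a β : RealSub E, a ≠ 0 ∧ p.valuation (RealSub E) β ≤ 1 ∧
      y = algebraMap (RealSub E) E a * (1 + algebraMap (RealSub E) E β * π) := by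
  obtain ⟨a, b, rfl⟩ := exists_eq_add_mul_uniformizer hp hπ y
  obtain ⟨k, hk⟩ := exists_valuation_eq_exp p ha'
  rw [valuation_add_mul_uniformizer hp hπ, map_mul, valuation_algebraMap_of_ramified hp,
    valuation_algebraMap_of_ramified hp, valuation_algebraMap_of_ramified hp, hπ, hk] at hy
  have ha : a ≠ 0 := by
    rintro rfl
    by_cases hb : b = 0
    · simp [hb, WithZero.exp_ne_zero.symm] at hy
    obtain ⟨m, hm⟩ := exists_valuation_eq_exp p hb
    rw [map_zero, zero_pow two_ne_zero, max_eq_right zero_le, hm, ← WithZero.exp_nsmul,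
      ← WithZero.exp_nsmul, ← WithZero.exp_add, WithZero.exp_inj] at hy
    simp at hy
    omega
  have haE : algebraMap (RealSub E) E a ≠ 0 := by simpa using ha
  refine ⟨a, b / a, ha, ?_, by rw [map_div₀]; field_simp⟩
  by_cases hb : b = 0
  · simp [hb]
  obtain ⟨l, hl⟩ := exists_valuation_eq_exp p ha
  obtain ⟨m, hm⟩ := exists_valuation_eq_exp p hb
  rw [hl, hm, ← WithZero.exp_nsmul, ← WithZero.exp_nsmul, ← WithZero.exp_nsmul,
    ← WithZero.exp_add] at hy
  rw [map_div₀, hl, hm, ← WithZero.exp_sub, ← WithZero.exp_zero, WithZero.exp_le_exp]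
  rcases max_cases (WithZero.exp (2 • l)) (WithZero.exp (2 • m + -1)) with ⟨h, h'⟩ | ⟨h, h'⟩
  · rw [WithZero.exp_le_exp] at h'
    simp at h'
    omega
  · rw [h, WithZero.exp_inj] at hy
    simp at hy
    omega

theorem valuation_one_add_mul_uniformizer {β : RealSub E} (hβ : p.valuation (RealSub E) β ≤ 1) :
    P.valuation E (1 + algebraMap (RealSub E) E β * π) = 1 := by
  refine Valuation.map_one_add_of_lt _ ?_
  rw [map_mul, hπ, valuation_algebraMap_of_ramified hp]
  refine (mul_le_of_le_one_left' (pow_le_one' hβ 2)).trans_lt ?_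
  rw [← WithZero.exp_zero, WithZero.exp_lt_exp]
  omega

/-- The factor `a ∈ F` cancels in `y / ȳ`, leaving `β (π - π̄)` over a unit. Closeness to the
conjugate thus becomes a lower bound on `v(β)`. -/
theorem valuation_conj_div_sub_one {d : ℕ}
    (hd : P.valuation E (π - c π) = WithZero.exp (-(d : ℤ))) {a β : RealSub E} (ha : a ≠ 0)
    (hβ : p.valuation (RealSub E) β ≤ 1) {y : E}
    (hy : y = algebraMap (RealSub E) E a * (1 + algebraMap (RealSub E) E β * π)) :
    P.valuation E (y / c y - 1) = p.valuation (RealSub E) β ^ 2 * WithZero.exp (-(d : ℤ)) := by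
  have h1 := valuation_one_add_mul_uniformizer hp hπ hβ
  have h2 : P.valuation E (c (1 + algebraMap (RealSub E) E β * π)) = 1 := by
    rw [valuation_complexConj_of_ramified hp, h1]
  have h3 : c (1 + algebraMap (RealSub E) E β * π) ≠ 0 := fun h ↦ by simp [h] at h2
  have haE : algebraMap (RealSub E) E a ≠ 0 := by simpa using ha
  have e : y / c y - 1 = algebraMap (RealSub E) E β * (π - c π) /
      c (1 + algebraMap (RealSub E) E β * π) := by
    rw [hy, map_mul, complexConj_algebraMap, mul_div_mul_left _ _ haE, div_sub_one h3]
    congr 1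
    simp only [map_add, map_mul, map_one, complexConj_algebraMap]
    ring
  rw [e, map_div₀, h2, div_one, map_mul, hd, valuation_algebraMap_of_ramified hp]

/-- The even part of the local invariant: an element whose valuation is that of an element of `F`
and which is close to its conjugate is determined by a residue class, up to `Fˣ` and up to
elements close to `1`. -/
theorem exists_even_invariant {d : ℕ}
    (hd : P.valuation E (π - c π) = WithZero.exp (-(d : ℤ))) (n : ℕ) :
    ∃ (N : ℕ) (f : E → 𝓞 (RealSub E) ⧸ p.asIdeal ^ N), 2 * N ≤ d ∧
      ∀ x y : E, (∃ a : RealSub E, a ≠ 0 ∧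
          P.valuation E x = P.valuation E (algebraMap (RealSub E) E a)) →
        (∃ a : RealSub E, a ≠ 0 ∧
          P.valuation E y = P.valuation E (algebraMap (RealSub E) E a)) →
        P.valuation E (x / c x - 1) ≤ WithZero.exp (-(n : ℤ)) →
        P.valuation E (y / c y - 1) ≤ WithZero.exp (-(n : ℤ)) → f x = f y →
        ∃ a : RealSub E, a ≠ 0 ∧
          P.valuation E (x / y / algebraMap (RealSub E) E a - 1) ≤ WithZero.exp (-(n : ℤ)) := by
  classical
  obtain ⟨ϖ, hϖ⟩ := p.valuation_exists_uniformizer (RealSub E)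
  -- Closeness to order `n` means `2 v(β) + d ≥ n`, that is `v(β) ≥ r`, with truncated subtraction
  -- giving `r = 0` when `n ≤ d`. Agreement up to `Fˣ` and `1 + P ^ n` needs only `2 v(β - β') + 1 ≥
  -- n`, that is `v(β - β') ≥ n / 2` rounded down. So `β / ϖ ^ r` matters modulo `p ^ N`, and `2 N ≤
  -- d`.
  set r := (n - d + 1) / 2 with hr
  set N := n / 2 - r with hN
  have hϖ0 : ϖ ≠ 0 := fun h ↦ by simp [h, WithZero.exp_ne_zero.symm] at hϖ
  have H (x : E) : ∃ γ : 𝓞 (RealSub E), (∃ a : RealSub E, a ≠ 0 ∧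
      P.valuation E x = P.valuation E (algebraMap (RealSub E) E a)) →
      P.valuation E (x / c x - 1) ≤ WithZero.exp (-(n : ℤ)) →
      ∃ a β : RealSub E, a ≠ 0 ∧ p.valuation (RealSub E) β ≤ 1 ∧
        x = algebraMap (RealSub E) E a * (1 + algebraMap (RealSub E) E β * π) ∧
        p.valuation (RealSub E) (β / ϖ ^ r - algebraMap _ _ γ) ≤ WithZero.exp (-(N : ℤ)) := by
    by_cases hx : (∃ a : RealSub E, a ≠ 0 ∧
      P.valuation E x = P.valuation E (algebraMap (RealSub E) E a)) ∧
      P.valuation E (x / c x - 1) ≤ WithZero.exp (-(n : ℤ))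
    · obtain ⟨⟨a', ha', hxa'⟩, hxn⟩ := hx
      obtain ⟨a, β, ha, hβ, hxe⟩ := exists_eq_mul_one_add hp hπ ha' hxa'
      rw [valuation_conj_div_sub_one hp hπ hd ha hβ hxe] at hxn
      have hβr : p.valuation (RealSub E) (β / ϖ ^ r) ≤ 1 := by
        by_cases hβ0 : β = 0
        · simp [hβ0]
        obtain ⟨m, hm⟩ := exists_valuation_eq_exp p hβ0
        rw [hm, ← WithZero.exp_nsmul, ← WithZero.exp_add, WithZero.exp_le_exp] at hxn
        rw [hm, ← WithZero.exp_zero, WithZero.exp_le_exp] at hβ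
        rw [map_div₀, map_pow, hϖ, hm, ← WithZero.exp_nsmul, ← WithZero.exp_sub,
          ← WithZero.exp_zero, WithZero.exp_le_exp]
        simp at hxn ⊢
        omega
      obtain ⟨γ, hγ⟩ := exists_valuation_sub_algebraMap_le p hβr N
      exact ⟨γ, fun _ _ ↦ ⟨a, β, ha, hβ, hxe, hγ⟩⟩
    · exact ⟨0, fun h h' ↦ absurd ⟨h, h'⟩ hx⟩
  choose γ hγ using H
  refine ⟨N, fun x ↦ Ideal.Quotient.mk _ (γ x), by omega, fun x y hx hy hxn hyn hxy ↦ ?_⟩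
  obtain ⟨a, β, ha, hβ, hxe, hxγ⟩ := hγ x hx hxn
  obtain ⟨a', β', ha', hβ', hye, hyγ⟩ := hγ y hy hyn
  rw [Ideal.Quotient.eq, ← valuation_algebraMap_le_iff (K := RealSub E), map_sub] at hxy
  have h1 : p.valuation (RealSub E) (β / ϖ ^ r - β' / ϖ ^ r) ≤ WithZero.exp (-(N : ℤ)) := by
    have e : β / ϖ ^ r - β' / ϖ ^ r = (β / ϖ ^ r - algebraMap _ _ (γ x)) +
      (algebraMap _ _ (γ x) - algebraMap _ _ (γ y)) - (β' / ϖ ^ r - algebraMap _ _ (γ y)) := by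
      ring
    rw [e]
    exact Valuation.map_sub_le _ (Valuation.map_add_le _ hxγ hxy) hyγ
  have h2 : p.valuation (RealSub E) (β - β') ≤ WithZero.exp (-((n / 2 : ℕ) : ℤ)) := by
    have e : β - β' = (β / ϖ ^ r - β' / ϖ ^ r) * ϖ ^ r := by field_simp
    rw [e, map_mul, map_pow, hϖ, ← WithZero.exp_nsmul]
    refine (mul_le_mul_left h1 _).trans ?_
    rw [← WithZero.exp_add, WithZero.exp_le_exp]
    simp
    omega
  have haE : algebraMap (RealSub E) E a ≠ 0 := by simpa using ha
  have haE' : algebraMap (RealSub E) E a' ≠ 0 := by simpa using ha'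
  have h3 := valuation_one_add_mul_uniformizer hp hπ hβ'
  have h4 : 1 + algebraMap (RealSub E) E β' * π ≠ 0 := fun h ↦ by simp [h] at h3
  refine ⟨a / a', div_ne_zero ha ha', ?_⟩
  have e : x / y / algebraMap (RealSub E) E (a / a') - 1 =
      algebraMap (RealSub E) E (β - β') * π / (1 + algebraMap (RealSub E) E β' * π) := by
    have e' : x / y / algebraMap (RealSub E) E (a / a') =
        (1 + algebraMap (RealSub E) E β * π) / (1 + algebraMap (RealSub E) E β' * π) := by
      rw [hxe, hye, map_div₀]
      field_simp
    rw [e', div_sub_one h4, map_sub]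
    congr 1
    ring
  rw [e, map_div₀, h3, div_one, map_mul, hπ, valuation_algebraMap_of_ramified hp]
  refine (mul_le_mul_left (pow_le_pow_left₀ zero_le h2 2) _).trans ?_
  rw [← WithZero.exp_nsmul, ← WithZero.exp_add, WithZero.exp_le_exp]
  simp
  omega

omit [IsCMField E] [Above P p] hp hπ in
theorem valuation_div_sub_one_le {n : ℕ} (hn : 0 < n) {u w : E}
    (hu : P.valuation E (u - 1) ≤ WithZero.exp (-(n : ℤ)))
    (hw : P.valuation E (w - 1) ≤ WithZero.exp (-(n : ℤ))) :
    P.valuation E (u / w - 1) ≤ WithZero.exp (-(n : ℤ)) := by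
  have h1 := valuation_eq_one_of_sub hn hw
  have hw0 : w ≠ 0 := fun h ↦ by simp [h] at h1
  have e : u / w - 1 = ((u - 1) - (w - 1)) / w := by
    rw [div_sub_one hw0]
    ring
  rw [e, map_div₀, h1, div_one]
  exact Valuation.map_sub_le _ hu hw

theorem exists_even_or_odd {x : E} (hx : x ≠ 0) :
    ∃ a : RealSub E, a ≠ 0 ∧ (P.valuation E x = P.valuation E (algebraMap (RealSub E) E a) ∨
      P.valuation E x = P.valuation E (algebraMap (RealSub E) E a * π)) := by
  obtain ⟨a, b, rfl⟩ := exists_eq_add_mul_uniformizer hp hπ x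
  have h := valuation_add_mul_uniformizer hp hπ a b
  by_cases ha : a = 0
  · refine ⟨b, ?_, Or.inr (by simp [ha])⟩
    rintro rfl
    simp [ha] at hx
  · by_cases hb : b = 0
    · exact ⟨a, ha, Or.inl (by simp [hb])⟩
    · rcases max_choice (P.valuation E (algebraMap (RealSub E) E a))
        (P.valuation E (algebraMap (RealSub E) E b * π)) with h' | h'
      · exact ⟨a, ha, Or.inl (h.trans h')⟩
      · exact ⟨b, hb, Or.inr (h.trans h')⟩

/-- The Boolean records the parity of the valuation. Odd elements are divided by a fixed odd
reference `z` that is itself close to its conjugate, which reduces them to the even case; without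
such a `z` every admissible element is even. -/
theorem exists_local_invariant {d : ℕ}
    (hd : P.valuation E (π - c π) = WithZero.exp (-(d : ℤ))) {n : ℕ} (hn : 0 < n) :
    ∃ (N : ℕ) (f : E → Bool × (𝓞 (RealSub E) ⧸ p.asIdeal ^ N)), 2 * N ≤ d ∧
      ∀ x y : E, x ≠ 0 → y ≠ 0 → P.valuation E (x / c x - 1) ≤ WithZero.exp (-(n : ℤ)) →
        P.valuation E (y / c y - 1) ≤ WithZero.exp (-(n : ℤ)) → f x = f y →
        ∃ a : RealSub E, a ≠ 0 ∧
          P.valuation E (x / y / algebraMap (RealSub E) E a - 1) ≤ WithZero.exp (-(n : ℤ)) := by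
  classical
  obtain ⟨N, g, hN, hg⟩ := exists_even_invariant hp hπ hd n
  let even : E → Prop := fun x ↦ ∃ a : RealSub E, a ≠ 0 ∧
    P.valuation E x = P.valuation E (algebraMap (RealSub E) E a)
  have hodd {x : E} (hx : x ≠ 0) (h : ¬ even x) : ∃ a : RealSub E, a ≠ 0 ∧
      P.valuation E x = P.valuation E (algebraMap (RealSub E) E a * π) := by
    obtain ⟨a, ha, h1 | h1⟩ := exists_even_or_odd hp hπ hx
    · exact absurd ⟨a, ha, h1⟩ h
    · exact ⟨a, ha, h1⟩
  have hdiv {x y : E} (hx : x ≠ 0) (hy : y ≠ 0) (hx' : ¬ even x) (hy' : ¬ even y) :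
      even (x / y) := by
    obtain ⟨a, ha, h1⟩ := hodd hx hx'
    obtain ⟨b, hb, h2⟩ := hodd hy hy'
    have hπ0 : P.valuation E π ≠ 0 := by rw [hπ]; exact WithZero.exp_ne_zero
    refine ⟨a / b, div_ne_zero ha hb, ?_⟩
    rw [map_div₀, map_div₀, map_div₀, h1, h2, map_mul, map_mul, mul_div_mul_right _ _ hπ0]
  by_cases h₀ : ∃ z : E, z ≠ 0 ∧ ¬ even z ∧
      P.valuation E (z / c z - 1) ≤ WithZero.exp (-(n : ℤ))
  · obtain ⟨z, hz, hze, hzn⟩ := h₀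
    refine ⟨N, fun x ↦ if even x then (true, g x) else (false, g (x / z)), hN,
      fun x y hx hy hxn hyn hxy ↦ ?_⟩
    by_cases hxe : even x <;> by_cases hye : even y
    · simp only [hxe, hye, if_true, Prod.mk.injEq, true_and] at hxy
      exact hg x y hxe hye hxn hyn hxy
    · simp [hxe, hye] at hxy
    · simp [hxe, hye] at hxy
    · simp only [hxe, hye, if_false, Prod.mk.injEq, true_and] at hxy
      have hquot {t : E} (ht : P.valuation E (t / c t - 1) ≤ WithZero.exp (-(n : ℤ))) :
          P.valuation E (t / z / c (t / z) - 1) ≤ WithZero.exp (-(n : ℤ)) := by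
        have e : t / z / c (t / z) = (t / c t) / (z / c z) := by
          rw [map_div₀, div_div_div_comm]
        rw [e]
        exact valuation_div_sub_one_le hn ht hzn
      have := hg (x / z) (y / z) (hdiv hx hz hxe hze) (hdiv hy hz hye hze) (hquot hxn)
        (hquot hyn) hxy
      rwa [div_div_div_cancel_right₀ hz] at this
  · refine ⟨N, fun x ↦ (true, g x), hN, fun x y hx hy hxn hyn hxy ↦ ?_⟩
    push Not at h₀
    have heven {t : E} (ht : t ≠ 0)
        (htn : P.valuation E (t / c t - 1) ≤ WithZero.exp (-(n : ℤ))) : even t := by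
      by_contra h
      exact absurd htn (not_le.2 (h₀ t ht h))
    exact hg x y (heven hx hxn) (heven hy hyn) hxn hyn (Prod.ext_iff.1 hxy).2

end RamifiedLocal

/-! ### From local conditions to the cohomology of `E^{I,1}`. -/

section GlobalH1

variable {E : Type u} [Field E] [NumberField E] [IsCMField E]

local notation "c" => IsCMField.complexConj E

/-- At a prime of `F` that is unramified or odd, some `t` of trace `1` is integral. -/
theorem exists_add_conj_eq_one {p : HeightOneSpectrum (𝓞 (RealSub E))}
    (hp : eFinite E p = 1 ∨ (2 : 𝓞 (RealSub E)) ∉ p.asIdeal) :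
    ∃ t : E, t + c t = 1 ∧
      ∀ P : HeightOneSpectrum (𝓞 E), Above P p → P.valuation E (c t) ≤ 1 := by
  rcases hp with hp | hp
  · obtain ⟨x, hx⟩ := exists_forall_conj_sub_notMem p hp
    have hval (P : HeightOneSpectrum (𝓞 E)) (hP : Above P p) :
        P.valuation E (c x - (x : E)) = 1 :=
      (HeightOneSpectrum.valuation_eq_one_iff_notMem (K := E) P
        (r := IsCMField.ringOfIntegersComplexConj E x - x)).2 (hx P hP)
    obtain ⟨P₀, hP₀, hP₀'⟩ := (inferInstance : Nonempty (Ideal.primesOver p.asIdeal (𝓞 E)))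
    have h0 : c x - (x : E) ≠ 0 := fun h ↦ by
      have := hval ⟨P₀, hP₀, Ideal.ne_bot_of_liesOver_of_ne_bot p.ne_bot P₀⟩ hP₀'
      simp [h] at this
    have h0' : (x : E) - c x ≠ 0 := fun h ↦ h0 (by rw [← neg_sub, h, neg_zero])
    -- The denominator is a unit at every prime above `p`, by the choice of `x`.
    refine ⟨-x / (c x - x), ?_, fun P hP ↦ ?_⟩
    · rw [map_div₀, map_neg, map_sub, complexConj_complexConj]
      field_simp
      ring
    · rw [map_div₀, map_neg, map_sub, complexConj_complexConj, map_div₀, Valuation.map_neg,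
        Valuation.map_sub_swap, hval P hP, div_one]
      exact P.valuation_le_one (IsCMField.ringOfIntegersComplexConj E x)
  · have hc : c (2 : E) = 2 := map_ofNat _ 2
    refine ⟨1 / 2, by rw [map_div₀, map_one, hc]; norm_num, fun P hP ↦ ?_⟩
    have h2 : (2 : 𝓞 E) ∉ P.asIdeal := fun h ↦ hp (by
      rw [Ideal.mem_of_liesOver P.asIdeal p.asIdeal, map_ofNat]
      exact h)
    have h3 := (HeightOneSpectrum.valuation_eq_one_iff_notMem (K := E) P).2 h2
    rw [map_ofNat] at h3
    simp [hc, h3]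

/-- The elements of `Eˣ` that are a product of an element of `F` and of an element that is close
to `1` at the primes above `p`. -/
def LocallyReal (I : Ideal (𝓞 E)) (p : HeightOneSpectrum (𝓞 (RealSub E))) (y : E) : Prop :=
  ∃ a : RealSub E, a ≠ 0 ∧ ∀ P : HeightOneSpectrum (𝓞 E), Above P p → 0 < ord P I →
    P.valuation E (y / algebraMap (RealSub E) E a - 1) ≤ WithZero.exp (-(ord P I : ℤ))

/-- With `t` integral of trace `1`, the element `a = Tr(ty)` of `F` satisfies `a / y - 1 = t̄ (ȳ / y
- 1)`, so it is as close to `y` as `ȳ` is. -/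
theorem locallyReal_of_tame {I : Ideal (𝓞 E)} {p : HeightOneSpectrum (𝓞 (RealSub E))}
    (hp : eFinite E p = 1 ∨ (2 : 𝓞 (RealSub E)) ∉ p.asIdeal) {y : E} (hy : y ≠ 0)
    (h : ∀ P : HeightOneSpectrum (𝓞 E), 0 < ord P I →
      P.valuation E (y / c y - 1) ≤ WithZero.exp (-(ord P I : ℤ))) :
    LocallyReal I p y := by
  by_cases hex : ∃ P : HeightOneSpectrum (𝓞 E), Above P p ∧ 0 < ord P I
  swap
  · exact ⟨1, one_ne_zero, fun P hP hPI ↦ absurd ⟨P, hP, hPI⟩ hex⟩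
  obtain ⟨t, ht, htv⟩ := exists_add_conj_eq_one hp
  obtain ⟨a, ha⟩ := exists_algebraMap_eq (x := t * y + c (t * y)) (by
    rw [map_add, complexConj_complexConj, add_comm])
  have hcy : c y ≠ 0 := by simpa using hy
  have key (P : HeightOneSpectrum (𝓞 E)) (hP : Above P p) (hPI : 0 < ord P I) :
      P.valuation E (algebraMap (RealSub E) E a / y - 1) ≤ WithZero.exp (-(ord P I : ℤ)) := by
    have e : algebraMap (RealSub E) E a / y - 1 = c t * (1 / (y / c y) - 1) := by
      have : t = 1 - c t := eq_sub_of_add_eq ht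
      rw [ha, map_mul, one_div_div]
      field_simp
      linear_combination y * ht
    rw [e, map_mul]
    exact mul_le_of_le_one_of_le (htv P hP)
      (valuation_div_sub_one_le hPI (by simp) (h P hPI))
  refine ⟨a, ?_, fun P hP hPI ↦ ?_⟩
  · rintro rfl
    obtain ⟨P, hP, hPI⟩ := hex
    have := valuation_eq_one_of_sub hPI (key P hP hPI)
    simp at this
  · have := valuation_div_sub_one_le hPI (u := 1) (by simp) (key P hP hPI)
    rwa [one_div_div] at this

theorem dvd_of_ord_pos {M : Type*} [Field M] {P : HeightOneSpectrum (𝓞 M)} {I : Ideal (𝓞 M)}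
    (h : 0 < ord P I) : P.asIdeal ∣ I :=
  dvd_of_multiplicity_pos h

/-- The prime of `F` below a prime of `E`. -/
def primeBelow (P : HeightOneSpectrum (𝓞 E)) : HeightOneSpectrum (𝓞 (RealSub E)) where
  asIdeal := P.asIdeal.under (𝓞 (RealSub E))
  isPrime := inferInstance
  ne_bot := Ideal.under_ne_bot _ P.ne_bot

instance above_primeBelow (P : HeightOneSpectrum (𝓞 E)) : Above P (primeBelow P) :=
  ⟨rfl⟩

omit [IsCMField E] in
theorem valuation_algebraMap_le_of_above {P : HeightOneSpectrum (𝓞 E)}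
    {p : HeightOneSpectrum (𝓞 (RealSub E))} [Above P p] {x : RealSub E} {M : ℕ}
    (hx : p.valuation (RealSub E) x ≤ WithZero.exp (-(M : ℤ))) :
    P.valuation E (algebraMap (RealSub E) E x) ≤ WithZero.exp (-(M : ℤ)) := by
  rw [← HeightOneSpectrum.valuation_liesOver E p P]
  have h1 : p.valuation (RealSub E) x ≤ 1 := hx.trans (by
    rw [← WithZero.exp_zero, WithZero.exp_le_exp]; omega)
  exact (pow_le_of_le_one zero_le h1
    (Ideal.IsDedekindDomain.ramificationIdx'_ne_zero_of_liesOver P.asIdeal p.ne_bot)).trans hx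

-- One `b ∈ F` approximating all the local elements `a` replaces them simultaneously.
omit [IsCMField E] in
theorem exists_div_mem_rayGroup {I : Ideal (𝓞 E)} (hI : I ≠ ⊥) {y : E}
    (hy : ∀ p : HeightOneSpectrum (𝓞 (RealSub E)), LocallyReal I p y) :
    ∃ a : RealSub E, a ≠ 0 ∧ ∀ P : HeightOneSpectrum (𝓞 E), 0 < ord P I →
      P.valuation E (y / algebraMap (RealSub E) E a - 1) ≤ WithZero.exp (-(ord P I : ℤ)) := by
  classical
  have hfin : {P : HeightOneSpectrum (𝓞 E) | 0 < ord P I}.Finite :=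
    (Ideal.finite_factors hI).subset fun P hP ↦ dvd_of_ord_pos hP
  by_cases hex : ∃ P : HeightOneSpectrum (𝓞 E), 0 < ord P I
  swap
  · exact ⟨1, one_ne_zero, fun P hPI ↦ absurd ⟨P, hPI⟩ hex⟩
  choose a ha hav using hy
  have hlog (P : HeightOneSpectrum (𝓞 E)) :
      ∃ m : ℤ, P.valuation E (algebraMap (RealSub E) E (a (primeBelow P))) = WithZero.exp m :=
    exists_valuation_eq_exp P (by simpa using ha _)
  choose m hm using hlog
  -- Since `-m P` is the additive valuation of the local element, precision `ord P I - m P` in `b -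
  -- a` gives precision `ord P I` in `b / a - 1`.
  obtain ⟨b, hb⟩ := exists_forall_valuation_sub_le (K := RealSub E)
    (hfin.toFinset.image primeBelow) a (hfin.toFinset.sup fun P ↦ (ord P I - m P : ℤ).toNat)
  have key (P : HeightOneSpectrum (𝓞 E)) (hPI : 0 < ord P I) :
      P.valuation E (algebraMap (RealSub E) E b / algebraMap (RealSub E) E (a (primeBelow P)) - 1)
        ≤ WithZero.exp (-(ord P I : ℤ)) := by
    have hPT : P ∈ hfin.toFinset := by simpa using hPI
    have h1 := valuation_algebraMap_le_of_above (P := P)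
      (hb (primeBelow P) (Finset.mem_image_of_mem _ hPT))
    have h2 : (ord P I - m P : ℤ).toNat ≤
        hfin.toFinset.sup fun P ↦ (ord P I - m P : ℤ).toNat :=
      Finset.le_sup (f := fun P ↦ (ord P I - m P : ℤ).toNat) hPT
    have h0 : algebraMap (RealSub E) E (a (primeBelow P)) ≠ 0 := by simpa using ha _
    rw [div_sub_one h0, ← map_sub, map_div₀, hm, div_le_iff₀ WithZero.exp_pos, ← WithZero.exp_add]
    refine h1.trans ?_
    rw [WithZero.exp_le_exp]
    omega
  refine ⟨b, ?_, fun P hPI ↦ ?_⟩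
  · rintro rfl
    obtain ⟨P, hPI⟩ := hex
    have := valuation_eq_one_of_sub hPI (key P hPI)
    simp at this
  · have h0 : algebraMap (RealSub E) E (a (primeBelow P)) ≠ 0 := by simpa using ha _
    have := valuation_div_sub_one_le hPI (hav (primeBelow P) P inferInstance hPI) (key P hPI)
    rwa [div_div_div_cancel_right₀ h0] at this

/-- The first Tate cohomology of `E^{I,1}` is group cohomology. -/
def rayH1Equiv {I : Ideal (𝓞 E)} (hI : ConjInvariant I) :
    rayH1 hI ≃ groupCohomology.H1 (rayRep hI) :=
  ((TateCohomology.isoGroupCohomology (R := ULift.{u} ℤ) (G := Gal(E/RealSub E)) 1).app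
    (rayRep hI)).toLinearEquiv.toEquiv

/-- The element of `Eˣ` underlying an element of the `G`-module `E^{I,1}`. -/
def rayVal {I : Ideal (𝓞 E)} {hI : ConjInvariant I} (x : rayRep hI) : Eˣ :=
  ((show Additive (rayGroup I) from x).toMul : Eˣ)

theorem rayVal_mem {I : Ideal (𝓞 E)} {hI : ConjInvariant I} (x : rayRep hI) :
    rayVal x ∈ rayGroup I :=
  (show Additive (rayGroup I) from x).toMul.2

theorem rayVal_injective {I : Ideal (𝓞 E)} {hI : ConjInvariant I} :
    Function.Injective (rayVal : rayRep hI → Eˣ) :=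
  fun _ _ h ↦ Additive.toMul.injective (Subtype.ext h)

theorem rayVal_add {I : Ideal (𝓞 E)} {hI : ConjInvariant I} (x y : rayRep hI) :
    rayVal (x + y) = rayVal x * rayVal y := rfl

theorem rayVal_sub {I : Ideal (𝓞 E)} {hI : ConjInvariant I} (x y : rayRep hI) :
    rayVal (x - y) = rayVal x / rayVal y := by
  rw [eq_div_iff_mul_eq', ← rayVal_add, sub_add_cancel]

theorem rayVal_ρ {I : Ideal (𝓞 E)} {hI : ConjInvariant I} (τ : Gal(E/RealSub E))
    (x : rayRep hI) : rayVal ((rayRep hI).ρ τ x) = τ • rayVal x := rfl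

open groupCohomology in
/-- By Hilbert's Theorem 90, `H¹(E^{I,1})` is detected by any invariant of
`{y ∈ Eˣ : y / ȳ ∈ E^{I,1}}` that separates the classes modulo `Fˣ E^{I,1}`. -/
theorem card_rayH1_le {I : Ideal (𝓞 E)} (hI : ConjInvariant I) {X : Type*} [Finite X]
    (f : E → X) (hf : ∀ x y : Eˣ, x / (c • x) ∈ rayGroup I → y / (c • y) ∈ rayGroup I →
      f x = f y → ∃ a : (RealSub E)ˣ,
        x / y / Units.map (algebraMap (RealSub E) E).toMonoidHom a ∈ rayGroup I) :
    Nat.card (rayH1 hI) ≤ Nat.card X := by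
  rw [Nat.card_congr (rayH1Equiv hI)]
  have h90 (h : H1 (rayRep hI)) : ∃ (z : cocycles₁ (rayRep hI)) (y : Eˣ), H1π _ z = h ∧
      ∀ τ : Gal(E/RealSub E), τ • y / y = rayVal (z τ) := by
    induction h using H1_induction_on with
    | h z =>
      obtain ⟨y, hy⟩ := isMulCoboundary₁_of_isMulCocycle₁_of_aut_to_units
        (fun τ ↦ rayVal (z τ)) (by
          intro τ τ'
          exact congrArg rayVal ((mem_cocycles₁_iff _).1 z.2 τ τ'))
      exact ⟨z, y, rfl, hy⟩
  choose z y hz hy using h90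
  refine Nat.card_le_card_of_injective (fun h ↦ f (y h)) fun h h' hhh ↦ ?_
  have hmem (h : H1 (rayRep hI)) : y h / (c • y h) ∈ rayGroup I := by
    rw [← inv_div, hy]
    exact inv_mem (rayVal_mem _)
  obtain ⟨a, ha⟩ := hf (y h) (y h') (hmem h) (hmem h') hhh
  rw [← hz h, ← hz h', H1π_eq_iff]
  -- The factor from `F` is Galois-invariant, so the coboundary of `w = y / (y' a)` is the
  -- difference of the two cocycles.
  let w : rayRep hI := Additive.ofMul (⟨_, ha⟩ : rayGroup I)
  have hw : rayVal w = y h / y h' / Units.map (algebraMap (RealSub E) E).toMonoidHom a := rfl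
  refine ⟨w, funext fun τ ↦ rayVal_injective ?_⟩
  have hfix : τ • Units.map (algebraMap (RealSub E) E).toMonoidHom a =
      Units.map (algebraMap (RealSub E) E).toMonoidHom a :=
    Units.ext (AlgEquiv.commutes τ (a : RealSub E))
  calc rayVal ((rayRep hI).ρ τ w - w) = τ • rayVal w / rayVal w := by rw [rayVal_sub, rayVal_ρ]
    _ = rayVal (z h τ) / rayVal (z h' τ) := by
      rw [hw, ← hy, ← hy, smul_div', smul_div', hfix]
      rw [div_div_div_cancel_right, div_div_div_comm]
    _ = rayVal (z h τ - z h' τ) := (rayVal_sub _ _).symm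

end GlobalH1

/-! ### Bounds for `eAway`, `#H¹` and the number of ramified primes. -/

section Bounds

variable {E : Type u} [Field E] [NumberField E] [IsCMField E]

local notation "c" => IsCMField.complexConj E

omit [NumberField E] [IsCMField E] in
theorem exists_above (p : HeightOneSpectrum (𝓞 (RealSub E))) :
    ∃ P : HeightOneSpectrum (𝓞 E), Above P p := by
  obtain ⟨⟨P₀, hP₀, hP₀'⟩⟩ := (inferInstance : Nonempty (Ideal.primesOver p.asIdeal (𝓞 E)))
  exact ⟨⟨P₀, hP₀, Ideal.ne_bot_of_liesOver_of_ne_bot p.ne_bot P₀⟩, hP₀'⟩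

/-- The integral form of the condition `y / ȳ ∈ E^{I,1}`. -/
def CloseToConj (I : Ideal (𝓞 E)) (y : E) : Prop :=
  ∀ P : HeightOneSpectrum (𝓞 E), 0 < ord P I →
    P.valuation E (y / c y - 1) ≤ WithZero.exp (-(ord P I : ℤ))

theorem CloseToConj.div {I : Ideal (𝓞 E)} {x y : E} (hx : CloseToConj I x)
    (hy : CloseToConj I y) : CloseToConj I (x / y) := fun P hP ↦ by
  rw [map_div₀, div_div_div_comm]
  exact valuation_div_sub_one_le hP (hx P hP) (hy P hP)

/-- The same `d`, independent of `I`, bounds the local invariant and divides the discriminant to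
order `d`; being at least `1`, it also shows that ramified primes divide the discriminant. -/
theorem exists_ramified_data {p : HeightOneSpectrum (𝓞 (RealSub E))} (hp : eFinite E p ≠ 1) :
    ∃ d : ℕ, 1 ≤ d ∧ relDiscr (RealSub E) E ≤ p.asIdeal ^ d ∧ ∀ I : Ideal (𝓞 E),
      ∃ (N : ℕ) (f : E → Bool × (𝓞 (RealSub E) ⧸ p.asIdeal ^ N)), 2 * N ≤ d ∧
        ∀ x y : E, x ≠ 0 → y ≠ 0 → CloseToConj I x → CloseToConj I y → f x = f y →
          LocallyReal I p (x / y) := by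
  obtain ⟨P, hP⟩ := exists_above p
  obtain ⟨π, d, hπ, hd1, hd⟩ := exists_uniformizer_conj_sub (P := P) hp
  refine ⟨d, hd1, relDiscr_le hp hπ hd.le, fun I ↦ ?_⟩
  by_cases hPI : 0 < ord P I
  · obtain ⟨N, f, hN, hf⟩ := exists_local_invariant hp hπ hd hPI
    refine ⟨N, f, hN, fun x y hx hy hxI hyI hxy ↦ ?_⟩
    obtain ⟨a, ha, h⟩ := hf x y hx hy (hxI P hPI) (hyI P hPI) hxy
    refine ⟨a, ha, fun Q hQ _ ↦ ?_⟩
    rw [← eq_of_above_of_ramified hp (P := P) (Q := Q)]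
    exact h
  · refine ⟨0, fun _ ↦ (true, 0), by omega, fun x y _ _ _ _ _ ↦ ⟨1, one_ne_zero, fun Q hQ hQI ↦ ?_⟩⟩
    rw [← eq_of_above_of_ramified hp (P := P) (Q := Q)] at hQI
    exact absurd hQI hPI

omit [IsCMField E] in
theorem relDiscr_ne_bot : relDiscr (RealSub E) E ≠ ⊥ := by
  classical
  let b := Module.finBasis (RealSub E) E
  obtain ⟨m, hm, hmb⟩ := exists_integral_multiples ℤ ℚ (Finset.univ.image b)
  have hmF : ((m : ℤ) : RealSub E) ≠ 0 := by exact_mod_cast hm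
  let b' := b.unitsSMul fun _ ↦ Units.mk0 (m : RealSub E) hmF
  have hb' (i) : IsIntegral ℤ (b' i) := by
    have h := hmb (b i) (Finset.mem_image_of_mem _ (Finset.mem_univ i))
    have e : b' i = m • b i := by
      rw [Module.Basis.unitsSMul_apply, Units.smul_mk0, Int.cast_smul_eq_zsmul]
    rwa [e]
  have hD : IsIntegral ℤ (Algebra.discr (RealSub E) b') :=
    Algebra.discr_isIntegral _ hb'
  intro h
  let D : 𝓞 (RealSub E) := ⟨_, hD⟩
  have hmem : D ∈ relDiscr (RealSub E) E := Ideal.subset_span ⟨b', hb', rfl⟩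
  rw [h] at hmem
  exact Algebra.discr_not_zero_of_basis (RealSub E) b'
    (congrArg (algebraMap (𝓞 (RealSub E)) (RealSub E)) (Ideal.mem_bot.1 hmem))

variable (E) in
theorem finite_ramified : {p : HeightOneSpectrum (𝓞 (RealSub E)) | eFinite E p ≠ 1}.Finite :=
  (Ideal.finite_factors (relDiscr_ne_bot (E := E))).subset fun p hp ↦ by
    obtain ⟨d, hd, h, -⟩ := exists_ramified_data hp
    exact (dvd_pow_self _ (by omega)).trans (Ideal.dvd_iff_le.2 h)

theorem eFinite_le_two (p : HeightOneSpectrum (𝓞 (RealSub E))) : eFinite E p ≤ 2 := by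
  by_cases hp : eFinite E p = 1
  · omega
  · obtain ⟨P, hP⟩ := exists_above p
    exact (eFinite_eq_two hp (P := P)).le

theorem eAway_le (J : Ideal (𝓞 (RealSub E))) :
    eAway E J ≤ 2 ^ Fintype.card (InfinitePlace (RealSub E)) *
      2 ^ {p : HeightOneSpectrum (𝓞 (RealSub E)) | eFinite E p ≠ 1 ∧ ¬ p.asIdeal ∣ J}.ncard := by
  have hfin : {p : HeightOneSpectrum (𝓞 (RealSub E)) | eFinite E p ≠ 1 ∧ ¬ p.asIdeal ∣ J}.Finite :=
    (finite_ramified E).subset fun p hp ↦ hp.1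
  refine Nat.mul_le_mul ?_ ?_
  · refine Finset.prod_le_pow_card _ _ _ fun v _ ↦ ?_
    unfold eInfinite
    split_ifs <;> omega
  · change ∏ᶠ p ∈ {p : HeightOneSpectrum (𝓞 (RealSub E)) | ¬ p.asIdeal ∣ J}, eFinite E p ≤ _
    rw [finprod_mem_eq_prod_of_inter_mulSupport_eq (s := {p | ¬ p.asIdeal ∣ J})
      (t := hfin.toFinset)]
    · rw [Set.ncard_eq_toFinset_card _ hfin]
      exact Finset.prod_le_pow_card _ _ _ fun p _ ↦ eFinite_le_two p
    · ext p
      simp [Function.mulSupport]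
      tauto

theorem absNorm_twoPart {M : Type*} [Field M] [NumberField M] {D : Ideal (𝓞 M)}
    {s : Finset (HeightOneSpectrum (𝓞 M))}
    (hs : ∀ p, p ∈ s ↔ (2 : 𝓞 M) ∈ p.asIdeal ∧ p.asIdeal ∣ D) :
    Ideal.absNorm (twoPart D) = ∏ p ∈ s, Ideal.absNorm p.asIdeal ^ ord p D := by
  have h : twoPart D = ∏ p ∈ s, p.asIdeal ^ ord p D := by
    refine finprod_mem_eq_prod_of_inter_mulSupport_eq
      (s := {p : HeightOneSpectrum (𝓞 M) | (2 : 𝓞 M) ∈ p.asIdeal}) _ ?_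
    ext p
    simp only [Set.mem_inter_iff, Set.mem_ofPred_eq, Function.mem_mulSupport, Finset.mem_coe, hs]
    refine ⟨fun ⟨h2, h⟩ ↦ ⟨⟨h2, ?_⟩, h⟩, fun ⟨⟨h2, h⟩, h'⟩ ↦ ⟨h2, h'⟩⟩
    by_contra hdvd
    exact h (by rw [ord, multiplicity_eq_zero.2 hdvd, pow_zero])
  rw [h, map_prod]
  simp only [map_pow]

theorem absNorm_ne_zero_of_prime {M : Type*} [Field M] [NumberField M]
    (p : HeightOneSpectrum (𝓞 M)) : Ideal.absNorm p.asIdeal ≠ 0 :=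
  mt Ideal.absNorm_eq_zero_iff.1 p.ne_bot

/-- Only the dyadic ramified primes dividing `J` carry an invariant. Each contributes at most `2
Nm(𝔭) ^ N` with `2 N ≤ d ≤ v_𝔭(d_{E/F})`, hence the square root. -/
theorem card_rayH1_le_two_pow_mul {I : Ideal (𝓞 E)} (hI0 : I ≠ ⊥) (hI : ConjInvariant I) :
    ((Nat.card (rayH1 hI) : ℕ) : ℝ) ≤
      2 ^ {p : HeightOneSpectrum (𝓞 (RealSub E)) |
          eFinite E p ≠ 1 ∧ p.asIdeal ∣ I.under (𝓞 (RealSub E))}.ncard *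
        √(Ideal.absNorm (twoPart (relDiscr (RealSub E) E)) : ℝ) := by
  classical
  set J := I.under (𝓞 (RealSub E)) with hJ
  set D := relDiscr (RealSub E) E with hD
  have hRfin : {p : HeightOneSpectrum (𝓞 (RealSub E)) | eFinite E p ≠ 1 ∧ p.asIdeal ∣ J}.Finite :=
    (finite_ramified E).subset fun p hp ↦ hp.1
  set S := hRfin.toFinset.filter fun p ↦ (2 : 𝓞 (RealSub E)) ∈ p.asIdeal with hS
  have hSmem (p) : p ∈ S ↔ (eFinite E p ≠ 1 ∧ p.asIdeal ∣ J) ∧ (2 : 𝓞 (RealSub E)) ∈ p.asIdeal := by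
    simp [hS]
  choose d hd1 hdD hdI using fun p : S ↦ exists_ramified_data ((hSmem p).1 p.2).1.1
  choose N f hN hf using fun p : S ↦ hdI p I
  have hfinq (p : S) : Finite (𝓞 (RealSub E) ⧸ p.1.asIdeal ^ N p) :=
    Ideal.finiteQuotientOfFreeOfNeBot _ (pow_ne_zero _ p.1.ne_bot)
  have hcard : Nat.card (rayH1 hI) ≤
      Nat.card ((p : S) → Bool × (𝓞 (RealSub E) ⧸ p.1.asIdeal ^ N p)) := by
    refine card_rayH1_le hI (fun x p ↦ f p x) fun x y hx hy hxy ↦ ?_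
    have hx' : CloseToConj I (x : E) := fun P hP ↦ by simpa using! hx P hP
    have hy' : CloseToConj I (y : E) := fun P hP ↦ by simpa using! hy P hP
    obtain ⟨a, ha, h⟩ := exists_div_mem_rayGroup (y := (x : E) / y) hI0 fun p ↦ by
      by_cases hp : (eFinite E p = 1 ∨ (2 : 𝓞 (RealSub E)) ∉ p.asIdeal)
      · exact locallyReal_of_tame hp (div_ne_zero x.ne_zero y.ne_zero) (hx'.div hy')
      by_cases hpJ : p.asIdeal ∣ J
      · push Not at hp
        let p' : S := ⟨p, (hSmem p).2 ⟨⟨hp.1, hpJ⟩, hp.2⟩⟩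
        exact hf p' x y x.ne_zero y.ne_zero hx' hy' (congrFun hxy p')
      -- A prime `P` above `p` dividing `I` would make `p` divide `J`, so here the condition is
      -- empty.
      · refine ⟨1, one_ne_zero, fun P hP hPI ↦ absurd ?_ hpJ⟩
        rw [Ideal.dvd_iff_le, hP.over]
        exact Ideal.comap_mono (Ideal.dvd_iff_le.1 (dvd_of_ord_pos hPI))
    exact ⟨Units.mk0 a ha, fun P hP ↦ by simpa using! h P hP⟩
  have hcard2 : Nat.card ((p : S) → Bool × (𝓞 (RealSub E) ⧸ p.1.asIdeal ^ N p)) =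
      2 ^ S.card * ∏ p : S, Ideal.absNorm p.1.asIdeal ^ N p := by
    rw [Nat.card_pi]
    simp only [Nat.card_prod, Nat.card_eq_fintype_card, Fintype.card_bool, Finset.prod_mul_distrib]
    congr 1
    · simp
    · refine Finset.prod_congr rfl fun p _ ↦ ?_
      rw [← map_pow, Ideal.absNorm_apply, Submodule.cardQuot_apply]
  have hTfin : {p : HeightOneSpectrum (𝓞 (RealSub E)) | p.asIdeal ∣ D}.Finite :=
    Ideal.finite_factors relDiscr_ne_bot
  set T := hTfin.toFinset.filter fun p ↦ (2 : 𝓞 (RealSub E)) ∈ p.asIdeal with hT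
  have hTmem (p) : p ∈ T ↔ (2 : 𝓞 (RealSub E)) ∈ p.asIdeal ∧ p.asIdeal ∣ D := by
    simp [hT, and_comm]
  have hprod : (∏ p : S, Ideal.absNorm p.1.asIdeal ^ N p) ^ 2 ≤ Ideal.absNorm (twoPart D) := by
    rw [absNorm_twoPart hTmem, ← Finset.prod_pow]
    calc ∏ p : S, (Ideal.absNorm p.1.asIdeal ^ N p) ^ 2
        ≤ ∏ p : S, Ideal.absNorm p.1.asIdeal ^ ord p.1 D := by
          refine Finset.prod_le_prod' fun p _ ↦ ?_
          rw [← pow_mul]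
          refine Nat.pow_le_pow_right (Nat.pos_of_ne_zero (absNorm_ne_zero_of_prime _)) ?_
          have hfm : FiniteMultiplicity p.1.asIdeal D :=
            FiniteMultiplicity.of_prime_left p.1.prime relDiscr_ne_bot
          have := hfm.le_multiplicity_of_pow_dvd (Ideal.dvd_iff_le.2 (hdD p))
          have h2 := hN p
          rw [ord]
          omega
      _ = ∏ p ∈ S, Ideal.absNorm p.asIdeal ^ ord p D :=
          Finset.prod_coe_sort S fun p ↦ Ideal.absNorm p.asIdeal ^ ord p D
      _ ≤ ∏ p ∈ T, Ideal.absNorm p.asIdeal ^ ord p D := by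
          refine Finset.prod_le_prod_of_subset_of_one_le' (fun p hp ↦ ?_) fun p _ _ ↦
            Nat.one_le_pow _ _ (Nat.pos_of_ne_zero (absNorm_ne_zero_of_prime _))
          have h1 := hd1 ⟨p, hp⟩
          exact (hTmem p).2 ⟨((hSmem p).1 hp).2,
            (dvd_pow_self _ (by omega)).trans (Ideal.dvd_iff_le.2 (hdD ⟨p, hp⟩))⟩
  have hSR : S.card ≤
      {p : HeightOneSpectrum (𝓞 (RealSub E)) | eFinite E p ≠ 1 ∧ p.asIdeal ∣ J}.ncard := by
    rw [Set.ncard_eq_toFinset_card _ hRfin]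
    exact Finset.card_filter_le _ _
  calc ((Nat.card (rayH1 hI) : ℕ) : ℝ)
      ≤ ((2 ^ S.card * ∏ p : S, Ideal.absNorm p.1.asIdeal ^ N p : ℕ) : ℝ) := by
        exact_mod_cast hcard.trans_eq hcard2
    _ = 2 ^ S.card * ((∏ p : S, Ideal.absNorm p.1.asIdeal ^ N p : ℕ) : ℝ) := by push_cast; rfl
    _ ≤ _ := by
        refine mul_le_mul (pow_le_pow_right₀ one_le_two hSR) (Real.le_sqrt_of_sq_le ?_)
          (Nat.cast_nonneg _) (by positivity)
        exact_mod_cast hprod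

theorem ncard_ramified_le (J : Ideal (𝓞 (RealSub E))) :
    {p : HeightOneSpectrum (𝓞 (RealSub E)) | eFinite E p ≠ 1 ∧ ¬ p.asIdeal ∣ J}.ncard +
      {p : HeightOneSpectrum (𝓞 (RealSub E)) | eFinite E p ≠ 1 ∧ p.asIdeal ∣ J}.ncard ≤
        omega (relDiscr (RealSub E) E) := by
  have h1 := (finite_ramified E).subset
    (fun p hp ↦ hp.1 : {p | eFinite E p ≠ 1 ∧ ¬ p.asIdeal ∣ J} ⊆ _)
  have h2 := (finite_ramified E).subset
    (fun p hp ↦ hp.1 : {p | eFinite E p ≠ 1 ∧ p.asIdeal ∣ J} ⊆ _)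
  rw [← Set.ncard_union_eq (Set.disjoint_left.2 fun p h h' ↦ h.2 h'.2) h1 h2]
  refine Set.ncard_le_ncard ?_ (Ideal.finite_factors (relDiscr_ne_bot (E := E)))
  rintro p (hp | hp) <;>
  · obtain ⟨d, hd, h, -⟩ := exists_ramified_data hp.1
    exact (dvd_pow_self _ (by omega)).trans (Ideal.dvd_iff_le.2 h)

end Bounds

end K3Totient

end

theorem mainTheorem4 (k : Type*) [Field k] [NumberField k]
    (E : Type*) [Field E] [NumberField E] [IsCMField E]
    (I : Ideal (𝓞 E)) (hI : K3Totient.IsPermissible k I) :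
    (K3Totient.totient I : ℝ) / K3Totient.totient (I.under (𝓞 (K3Totient.RealSub E))) ≤
      (Module.finrank ℚ k : ℝ) * K3Totient.mConst E := by
  refine hI.le.trans ?_
  set J := I.under (𝓞 (K3Totient.RealSub E))
  set R : ℝ := ((K3Totient.rayUnits I).index : ℝ) / ((K3Totient.rayUnits I).map
    (Units.map (RingOfIntegers.norm (K3Totient.RealSub E)))).index with hR
  have hunits : R * 2 ^ Fintype.card (InfinitePlace (K3Totient.RealSub E)) ≤
      2 * (IsCMField.realUnits E).index := by
    rw [hR, div_mul_eq_mul_div]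
    refine div_le_of_le_mul₀ (Nat.cast_nonneg _) (by positivity) ?_
    exact_mod_cast K3Totient.index_rayUnits_mul_le I
  have haway : (K3Totient.eAway E J : ℝ) ≤ _ := Nat.cast_le.2 (K3Totient.eAway_le J)
  have hH := K3Totient.card_rayH1_le_two_pow_mul hI.ne_bot hI.conj
  have hram := K3Totient.ncard_ramified_le J
  push_cast at haway
  set m := {p : HeightOneSpectrum (𝓞 (K3Totient.RealSub E)) |
    K3Totient.eFinite E p ≠ 1 ∧ ¬ p.asIdeal ∣ J}.ncard
  set m' := {p : HeightOneSpectrum (𝓞 (K3Totient.RealSub E)) |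
    K3Totient.eFinite E p ≠ 1 ∧ p.asIdeal ∣ J}.ncard
  set A : ℝ := 2 ^ Fintype.card (InfinitePlace (K3Totient.RealSub E))
  set U : ℝ := ((IsCMField.realUnits E).index : ℝ)
  set h : ℝ := (classNumber (K3Totient.RealSub E) : ℝ) / classNumber E with hh
  set s := √(Ideal.absNorm (K3Totient.twoPart (K3Totient.relDiscr (K3Totient.RealSub E) E)) : ℝ)
  set w := K3Totient.omega (K3Totient.relDiscr (K3Totient.RealSub E) E)
  set w' := K3Totient.omega (K3Totient.twoPart (K3Totient.relDiscr (K3Totient.RealSub E) E))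
  have hM : K3Totient.mConst E = U * h * 2 ^ (w + w') * s := by
    rw [K3Totient.mConst, hh, ← mul_div_assoc]
  have hR0 : 0 ≤ R := by positivity
  have hh0 : 0 ≤ h := by positivity
  have hs0 : 0 ≤ s := Real.sqrt_nonneg _
  have hU0 : 0 ≤ U := Nat.cast_nonneg _
  calc 1 / 2 * (Module.finrank ℚ k : ℝ) * R * h * K3Totient.eAway E J *
        Nat.card (K3Totient.rayH1 hI.conj)
      ≤ 1 / 2 * (Module.finrank ℚ k : ℝ) * R * h * (A * 2 ^ m) * (2 ^ m' * s) := by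
        gcongr
    _ = 1 / 2 * (Module.finrank ℚ k : ℝ) * (R * A) * h * 2 ^ (m + m') * s := by ring
    _ ≤ 1 / 2 * (Module.finrank ℚ k : ℝ) * (2 * U) * h * 2 ^ (w + w') * s := by
        gcongr 1 / 2 * _ * ?_ * h * ?_ * s
        -- Already `m + m' ≤ w`; the additional `w'` in the exponent is slack.
        exact pow_le_pow_right₀ one_le_two (by omega)
    _ = _ := by rw [hM]; ring
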